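/- Let $\mathbb{R}_+=[0,\infty)$, $0<k<1$, $1\le s\le\infty$ and $\lambda=\dfrac{k}{2-1/s}$ (with $1/\infty=0$). All norms below are over $\mathbb{R}_+$ with Lebesgue measure. Let $L^2_{\infty,s}(\mathbb{R}_+)$ be the space of functions $f\in L_\infty(\mathbb{R}_+)$ that are differentiable on $\mathbb{R}_+$ (one-sidedly at $0$), whose derivative $f'$ is locally absolutely continuous on $\mathbb{R}_+$, and for which $f''\in L_s(\mathbb{R}_+)$. The right-hand sided Marchaud derivative of order $k$ is $$D^k_-f(x)=\frac{k}{\Gamma(1-k)}\int_0^{\infty}\frac{f(x)-f(x+t)}{t^{1+k}}\,dt,\qquad x\in\mathbb{R}_+ .$$ For $s>1$ let $s'=s/(s-1)$ ($s'=1$ if $s=\infty$), let $g_{k,s}(t)=(t^{1-k}-t)^{s'-1}$ for $t\in(0,1)$ and $g_{k,s}(t)=0$ for all other $t\geq 0$, and set $$\varphi_{k,s}(x)=\int_0^1\Bigl(-x+\frac t2\Bigr)g_{k,s}(t)\,dt+\int_0^x(x-t)\,g_{k,s}(t)\,dt,\qquad \Phi_{k,s}=\frac{\varphi_{k,s}}{\|\varphi_{k,s}''\|_{L_s}}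 .$$ For $s=1$ set $$\Phi_{k,1}(x)=\tfrac12\max\bigl\{(1-k)^{1/k}-2x,\;-(1-k)^{1/k}\bigr\}.$$ Then: 1. for every $f\in L^2_{\infty,s}(\mathbb{R}_+)$ the integral defining $D^k_-f(x)$ converges absolutely for every $x\ge0$, and $D^k_-f\in L_\infty(\mathbb{R}_+)$; likewise $\Phi_{k,s}\in L_\infty(\mathbb{R}_+)$, $\|\Phi_{k,s}\|_{L_\infty}>0$, the integral defining $D^k_-\Phi_{k,s}(x)$ converges absolutely for every $x\ge 0$, and $D^k_-\Phi_{k,s}\in L_\infty(\mathbb{R}_+)$; 2. for every $f\in L^2_{\infty,s}(\mathbb{R}_+)$, $$\|D^k_-f\|_{L_\infty}\le\frac{\|D^k_-\Phi_{k,s}\|_{L_\infty}}{\|\Phi_{k,s}\|_{L_\infty}^{1-\lambda}}\;\|f\|_{L_\infty}^{1-\lambda}\,\|f''\|_{L_s}^{\lambda},$$ and the inequality is sharp: the constant on the right-hand side cannot be replaced by any smaller real number; 3. if $s>1$, then $\Phi_{k,s}\in L^2_{\infty,s}(\mathbb{R}_+)$, $\|\Phi_{k,s}''\|_{L_s}=1$,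 and the inequality turns into an equality for $f=\Phi_{k,s}$. -/

import Mathlib

open MeasureTheory
open scoped ENNReal

namespace HalfLine

/-- The finite difference with step `t` in the direction of the right-hand sided derivative:
`∑ (-1)^m (n choose m) f (x + m t)`, `0 ≤ m ≤ n`. -/
noncomputable def difference (n : ℕ) (t : ℝ) (f : ℝ → ℝ) (x : ℝ) : ℝ :=
  ∑ m ∈ Finset.range (n + 1), (-1 : ℝ) ^ m * (n.choose m : ℝ) * f (x + m * t)

/-- The normalizing constant `Γ(-k) ∑ (-1)^m (n choose m) m^k`, `0 ≤ m ≤ n`. -/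
noncomputable def kappa (k : ℝ) (n : ℕ) : ℝ :=
  Real.Gamma (-k) * ∑ m ∈ Finset.range (n + 1), (-1 : ℝ) ^ m * (n.choose m : ℝ) * (m : ℝ) ^ k

/-- The order of the difference in the Marchaud derivative of order `k`: the least natural
number greater than `k` (any larger one gives the same derivative). -/
noncomputable def diffOrder (k : ℝ) : ℕ := ⌊k⌋₊ + 1

/-- The integrand of the Marchaud derivative of order `k` at `x`. -/
noncomputable def marchaudIntegrand (k : ℝ) (f : ℝ → ℝ) (x t : ℝ) : ℝ :=
  difference (diffOrder k) t f x / t ^ (1 + k)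

/-- The integral defining the Marchaud derivative of order `k` at `x` converges absolutely. -/
def MarchaudExists (k : ℝ) (f : ℝ → ℝ) (x : ℝ) : Prop :=
  IntegrableOn (marchaudIntegrand k f x) (Set.Ioi 0)

/-- The right-hand sided Marchaud derivative of order `k`. For `x ≥ 0` it uses only the values
of `f` on `[0, ∞)`. -/
noncomputable def marchaud (k : ℝ) (f : ℝ → ℝ) (x : ℝ) : ℝ :=
  (1 / kappa k (diffOrder k)) * ∫ t in Set.Ioi (0 : ℝ), marchaudIntegrand k f x t

/-- Lebesgue measure on the half-line `[0, ∞)`. -/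
noncomputable def mu : Measure ℝ := volume.restrict (Set.Ici 0)

/-- The norm of `L_p` on `[0, ∞)`, as a real number; used only for elements of `L_p`. -/
noncomputable def norm (p : ℝ≥0∞) (f : ℝ → ℝ) : ℝ := (eLpNorm f p mu).toReal

/-- The first derivative on `[0, ∞)` (one-sided at `0`). -/
noncomputable def deriv1 (f : ℝ → ℝ) : ℝ → ℝ := derivWithin f (Set.Ici 0)

/-- The second derivative on `[0, ∞)`. -/
noncomputable def deriv2 (f : ℝ → ℝ) : ℝ → ℝ := deriv1 (deriv1 f)

/-- The space of functions in `L_∞` on `[0, ∞)` whose first derivative is locally absolutely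
continuous on `[0, ∞)` and whose second derivative is in `L_s`. Functions on the half-line are
represented by functions on `ℝ`, only the values on `[0, ∞)` of which matter. -/
structure MemL2 (s : ℝ≥0∞) (f : ℝ → ℝ) : Prop where
  memLp : MemLp f ⊤ mu
  differentiableOn : DifferentiableOn ℝ f (Set.Ici 0)
  absolutelyContinuous : ∀ b : ℝ, 0 ≤ b → AbsolutelyContinuousOnInterval (deriv1 f) 0 b
  memLp_deriv2 : MemLp (deriv2 f) s mu

/-- `x^(1-k) - x` on `[0, 1)` and `0` on `[1, ∞)`. -/
noncomputable def tau (k x : ℝ) : ℝ := if x ∈ Set.Ico (0 : ℝ) 1 then x ^ (1 - k) - x else 0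

/-- The power `tau^(s'-1)` on `(0, 1)`, where `s' = s/(s-1)` (so that `s' = 1` for `s = ∞`);
it is `0` outside `(0, 1)`, also for `s = ∞`. -/
noncomputable def tauPow (k : ℝ) (s : ℝ≥0∞) : ℝ → ℝ :=
  Set.indicator (Set.Ioo 0 1) (fun t => tau k t ^ (s.conjExponent.toReal - 1))

noncomputable def phi (k : ℝ) (s : ℝ≥0∞) (x : ℝ) : ℝ :=
  (∫ t in (0 : ℝ)..1, (-x + t / 2) * tauPow k s t) + ∫ t in (0 : ℝ)..x, (x - t) * tauPow k s t

open Classical in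
/-- The extremal function: for `s > 1`, `phi` normalized by the `L_s` norm of its second
derivative; for `s = 1`, a piecewise linear function. -/
noncomputable def Phi (k : ℝ) (s : ℝ≥0∞) (x : ℝ) : ℝ :=
  if s = 1 then (1 / 2) * max ((1 - k) ^ (1 / k) - 2 * x) (-(1 - k) ^ (1 / k))
  else (norm s (deriv2 (phi k s)))⁻¹ * phi k s x

/-- `k / (2 - 1/s)`, with `1/∞ = 0`. -/
noncomputable def lam (k : ℝ) (s : ℝ≥0∞) : ℝ := k / (2 - (1 / s).toReal)

/-- The constant `‖D^k Phi‖_∞ / ‖Phi‖_∞^(1-lam)`. -/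
noncomputable def sharpConst (k : ℝ) (s : ℝ≥0∞) : ℝ :=
  norm ⊤ (marchaud k (Phi k s)) / norm ⊤ (Phi k s) ^ (1 - lam k s)

end HalfLine

namespace HalfLine
open Set Filter Topology

/-! Fix `x ≥ 0` and a step `h > 0`. Splitting the Marchaud integral at `t = h`, rescaling, and
integrating by parts twice on the inner piece expresses `k (1 - k) h ^ k` times the integral as `∫
(u ^ (1 - k) - u) h² f''(x + h u)` over `[0, 1]`, plus `k (f x - f (x + h))`, plus `k (1 - k) ∫ (f x
- f (x + h u)) / u ^ (1 + k)` over `[1, ∞)`; this is `MemL2.integral_eq`. The last two terms are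
together at most `2 ‖f‖_∞`. By Hölder the first is at most `N h ^ (2 - 1/s) ‖f''‖_s`, where `N` is
the `L_{s'}` norm of the kernel `tau`. A suitable `h` turns this additive bound into the
multiplicative one, with constant proportional to `(2 M + N) / M ^ (1 - λ)` for any chosen `M > 0`
(`MemL2.abs_marchaud_le`).

At `x = 0`, `h = 1` every estimate is an equality if `f 0 = ‖f‖_∞`, `f = -‖f‖_∞` on `[1, ∞)`, and
`f''` is a dual function of `tau` for Hölder's inequality. `profile` builds such an `f` from its
second derivative. For `s > 1` this is `Phi`, and `M = ‖Phi‖_∞` gives the sharp constant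
(`norm_marchaud_Phi`).

For `s = 1` the dual object is a point mass at the maximum point `kink k` of `tau`, so `Phi k 1` is
piecewise linear and lies outside the space. Profiles of narrow bumps centred at the kink approach
it, and the constant is then only approximated (`sharp_one`). -/

/-! ### Integration by parts on the unit interval -/

theorem intervalIntegrable_rpow_neg {k : ℝ} (hk1 : k < 1) (a b : ℝ) :
    IntervalIntegrable (fun t : ℝ => t ^ (-k)) volume a b :=
  intervalIntegral.intervalIntegrable_rpow' (by linarith)

/-- Integration by parts against the kernel `t ^ (1 - k) - t`. -/
theorem integral_kernel_mul {k : ℝ} (hk1 : k < 1) {F1 w : ℝ → ℝ}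
    (hw : IntervalIntegrable w volume 0 1)
    (hF1 : ∀ u ∈ Icc (0 : ℝ) 1, F1 u = F1 0 + ∫ v in (0 : ℝ)..u, w v) :
    ∫ t in (0 : ℝ)..1, (t ^ (1 - k) - t) * w t =
      -∫ t in (0 : ℝ)..1, ((1 - k) * t ^ (-k) - 1) * F1 t := by
  set q : ℝ → ℝ := fun t => (1 - k) * t ^ (-k) - 1 with hq
  have hqi : ∀ a b : ℝ, IntervalIntegrable q volume a b := fun a b =>
    ((intervalIntegrable_rpow_neg hk1 a b).const_mul _).sub intervalIntegrable_const
  set P : ℝ → ℝ := fun u => ∫ v in (0 : ℝ)..u, q v with hP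
  set A : ℝ → ℝ := fun u => ∫ v in (0 : ℝ)..u, w v with hA
  have hPval : ∀ u ∈ Icc (0 : ℝ) 1, P u = u ^ (1 - k) - u := by
    intro u hu
    simp only [hP, hq]
    rw [intervalIntegral.integral_sub ((intervalIntegrable_rpow_neg hk1 0 u).const_mul _)
      intervalIntegrable_const, intervalIntegral.integral_const_mul,
      integral_rpow (Or.inl (by linarith))]
    have h1 : (-k + 1) = 1 - k := by ring
    rw [h1, Real.zero_rpow (by linarith)]
    have : (1 - k) ≠ 0 := by linarith
    simp
    field_simp
  -- The density `q` is unbounded at `0` and `w` is merely integrable, so integration by parts is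
  -- carried out for absolutely continuous functions.
  have hPac : AbsolutelyContinuousOnInterval P 0 1 :=
    (hqi 0 1).absolutelyContinuousOnInterval_intervalIntegral (by simp)
  have hAac : AbsolutelyContinuousOnInterval A 0 1 :=
    hw.absolutelyContinuousOnInterval_intervalIntegral (by simp)
  have hB : AbsolutelyContinuousOnInterval (fun u => F1 0 + A u) 0 1 := by
    have hc : AbsolutelyContinuousOnInterval (fun _ : ℝ => F1 0) 0 1 :=
      (LipschitzOnWith.absolutelyContinuousOnInterval (K := 0) (by
        intro x _ y _; simp))
    exact hc.add hAac
  have key := hPac.integral_mul_deriv_eq_deriv_mul hB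
  have e1 : ∫ t in (0 : ℝ)..1, P t * deriv (fun u => F1 0 + A u) t =
      ∫ t in (0 : ℝ)..1, (t ^ (1 - k) - t) * w t := by
    apply intervalIntegral.integral_congr_ae
    filter_upwards [hw.ae_hasDerivAt_integral] with t ht htm
    have hm : t ∈ uIcc (0 : ℝ) 1 := uIoc_subset_uIcc htm
    have hd := (ht hm 0 (by simp)).const_add (F1 0)
    rw [hd.deriv, hPval t (by rwa [uIcc_of_le zero_le_one] at hm)]
  have e2 : ∫ t in (0 : ℝ)..1, deriv P t * (F1 0 + A t) = ∫ t in (0 : ℝ)..1, q t * F1 t := by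
    apply intervalIntegral.integral_congr_ae
    filter_upwards [(hqi 0 1).ae_hasDerivAt_integral] with t ht htm
    have hm : t ∈ uIcc (0 : ℝ) 1 := uIoc_subset_uIcc htm
    have hd := ht hm 0 (by simp)
    rw [hd.deriv, hF1 t (by rwa [uIcc_of_le zero_le_one] at hm)]
  -- The kernel vanishes at both endpoints, so no boundary term survives.
  have p1 : P 1 = 0 := by rw [hPval 1 (by simp)]; simp
  have p0 : P 0 = 0 := by simp [hP]
  simp only [e1, e2, p1, p0] at key
  simpa using key

/-- The second integration by parts: `t ^ (-k) (F t - F 0)` has derivative `t ^ (-k) F1 t + k (F 0 -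
F t) / t ^ (1 + k)`, which trades the singular integral for one of `t ^ (-k) F1`. The linear bound
`L * t` removes the boundary term at `0`, since `k < 1`. -/
theorem integral_difference_zero_one {k : ℝ} (hk1 : k < 1) {F F1 w : ℝ → ℝ}
    (hw : IntervalIntegrable w volume 0 1)
    (hF1 : ∀ u ∈ Icc (0 : ℝ) 1, F1 u = F1 0 + ∫ v in (0 : ℝ)..u, w v)
    (hF : ContinuousOn F (Icc 0 1)) (hd : ∀ u ∈ Ioo (0 : ℝ) 1, HasDerivAt F (F1 u) u)
    (hi : IntervalIntegrable (fun t => (F 0 - F t) / t ^ (1 + k)) volume 0 1) {L : ℝ}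
    (hL : ∀ t ∈ Icc (0 : ℝ) 1, |F 0 - F t| ≤ L * t) :
    k * (1 - k) * ∫ t in (0 : ℝ)..1, (F 0 - F t) / t ^ (1 + k) =
      (∫ t in (0 : ℝ)..1, (t ^ (1 - k) - t) * w t) + k * (F 0 - F 1) := by
  have hF1c : ContinuousOn F1 (uIcc 0 1) := by
    have hAac : AbsolutelyContinuousOnInterval (fun u => ∫ v in (0 : ℝ)..u, w v) 0 1 :=
      hw.absolutelyContinuousOnInterval_intervalIntegral (by simp)
    refine (continuousOn_const.add hAac.continuousOn : ContinuousOn (fun u => F1 0 + _) _).congr ?_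
    intro u hu
    exact hF1 u (by rwa [uIcc_of_le zero_le_one] at hu)
  have hF1i : IntervalIntegrable F1 volume 0 1 := hF1c.intervalIntegrable
  have hri := intervalIntegrable_rpow_neg hk1 0 1
  have hrF : IntervalIntegrable (fun t => t ^ (-k) * F1 t) volume 0 1 :=
    hri.mul_continuousOn hF1c
  have f1 : ∫ t in (0 : ℝ)..1, F1 t = F 1 - F 0 :=
    intervalIntegral.integral_eq_sub_of_hasDerivAt_of_le zero_le_one hF hd hF1i
  have f2 : ∫ t in (0 : ℝ)..1, (t ^ (-k) * F1 t + k * ((F 0 - F t) / t ^ (1 + k))) =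
      F 1 - F 0 := by
    have hder : ∀ u ∈ Ioo (0 : ℝ) 1, HasDerivAt (fun t => t ^ (-k) * (F t - F 0))
        (u ^ (-k) * F1 u + k * ((F 0 - F u) / u ^ (1 + k))) u := by
      intro u hu
      have h1 := (Real.hasDerivAt_rpow_const (x := u) (p := -k) (Or.inl hu.1.ne')).mul
        ((hd u hu).sub_const (F 0))
      refine h1.congr_deriv ?_
      have : u ^ (1 + k) = (u ^ (-k - 1))⁻¹ := by
        rw [← Real.rpow_neg hu.1.le]; ring_nf
      rw [this]
      field_simp
      ring
    have hcont : ContinuousOn (fun t => t ^ (-k) * (F t - F 0)) (Icc 0 1) := by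
      intro t ht
      rcases ht.1.eq_or_lt with rfl | h0
      · have hb : Tendsto (fun t : ℝ => L * t ^ (1 - k)) (𝓝[Icc 0 1] 0) (𝓝 0) := by
          have : ContinuousAt (fun t : ℝ => L * t ^ (1 - k)) 0 :=
            continuousAt_const.mul (Real.continuousAt_rpow_const _ _ (Or.inr (by linarith)))
          have h := this.tendsto
          rw [Real.zero_rpow (by linarith), mul_zero] at h
          exact h.mono_left nhdsWithin_le_nhds
        have : Tendsto (fun t => t ^ (-k) * (F t - F 0)) (𝓝[Icc 0 1] 0) (𝓝 0) := by
          refine squeeze_zero_norm' ?_ hb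
          filter_upwards [self_mem_nhdsWithin] with u hu
          rcases hu.1.eq_or_lt with rfl | hu0
          · simp [Real.zero_rpow (by linarith : (1 - k) ≠ 0)]
          · rw [norm_mul, Real.norm_eq_abs, Real.norm_eq_abs, abs_of_pos (Real.rpow_pos_of_pos hu0 _),
              abs_sub_comm]
            calc u ^ (-k) * |F 0 - F u| ≤ u ^ (-k) * (L * u) := by
                  gcongr
                  exact hL u hu
              _ = L * (u ^ (-k) * u ^ (1 : ℝ)) := by rw [Real.rpow_one]; ring
              _ = L * u ^ (1 - k) := by rw [← Real.rpow_add hu0]; ring_nf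
        simpa [ContinuousWithinAt] using this
      · exact (Real.continuousAt_rpow_const _ _ (Or.inl h0.ne')).continuousWithinAt.mul
          ((hF t ht).sub continuousWithinAt_const)
    rw [intervalIntegral.integral_eq_sub_of_hasDerivAt_of_le zero_le_one hcont hder
      (hrF.add (hi.const_mul k))]
    simp
  rw [intervalIntegral.integral_add hrF (hi.const_mul k), intervalIntegral.integral_const_mul] at f2
  have f3 : ∫ t in (0 : ℝ)..1, ((1 - k) * t ^ (-k) - 1) * F1 t =
      (1 - k) * (∫ t in (0 : ℝ)..1, t ^ (-k) * F1 t) - ∫ t in (0 : ℝ)..1, F1 t := by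
    rw [← intervalIntegral.integral_const_mul, ← intervalIntegral.integral_sub (hrF.const_mul _) hF1i]
    congr 1; ext t; ring
  rw [integral_kernel_mul hk1 hw hF1, f3, f1]
  linear_combination (1 - k) * f2

/-! ### The Marchaud derivative for orders below one -/

theorem diffOrder_eq_one {k : ℝ} (hk1 : k < 1) : diffOrder k = 1 := by
  have : ⌊k⌋₊ = 0 := Nat.floor_eq_zero.2 hk1
  simp [diffOrder, this]

theorem marchaudIntegrand_eq {k : ℝ} (hk1 : k < 1) (f : ℝ → ℝ) (x t : ℝ) :
    marchaudIntegrand k f x t = (f x - f (x + t)) / t ^ (1 + k) := by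
  simp [marchaudIntegrand, diffOrder_eq_one hk1, difference, Finset.sum_range_succ,
    sub_eq_add_neg]

/-- Only the term `m = 1` survives, so the constant is `-Γ(-k) = Γ(1 - k) / k`. -/
theorem kappa_pos {k : ℝ} (hk0 : 0 < k) (hk1 : k < 1) : 0 < kappa k (diffOrder k) := by
  have h : Real.Gamma (1 - k) = -k * Real.Gamma (-k) := by
    rw [← Real.Gamma_add_one (by linarith)]; ring_nf
  have h2 : 0 < Real.Gamma (1 - k) := Real.Gamma_pos_of_pos (by linarith)
  have h3 : Real.Gamma (-k) < 0 := by
    by_contra hc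
    push Not at hc
    nlinarith [mul_nonneg hk0.le hc]
  simp [kappa, diffOrder_eq_one hk1, Finset.sum_range_succ, Real.zero_rpow hk0.ne', h3]

theorem marchaud_eq {k : ℝ} (hk1 : k < 1) (f : ℝ → ℝ) (x : ℝ) :
    marchaud k f x =
      (1 / kappa k (diffOrder k)) * ∫ t in Ioi (0 : ℝ), (f x - f (x + t)) / t ^ (1 + k) := by
  simp only [marchaud, marchaudIntegrand_eq hk1]

/-! ### Existence and continuity of the derivative -/

/-- `f` is bounded by `M` on the half-line and Lipschitz on every `[0, b]`. -/
structure Tame (M : ℝ) (f : ℝ → ℝ) : Prop where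
  continuousOn : ContinuousOn f (Ici 0)
  abs_le : ∀ x, 0 ≤ x → |f x| ≤ M
  lipschitz : ∀ b : ℝ, ∃ L : ℝ, ∀ x ∈ Icc 0 b, ∀ y ∈ Icc 0 b, |f x - f y| ≤ L * |x - y|

theorem Tame.exists_step {M : ℝ} {f : ℝ → ℝ} (hf : Tame M f) (b : ℝ) :
    ∃ L : ℝ, ∀ x ∈ Icc 0 b, ∀ t ∈ Icc (0 : ℝ) 1, |f x - f (x + t)| ≤ L * t := by
  obtain ⟨L, hL⟩ := hf.lipschitz (b + 1)
  refine ⟨L, fun x hx t ht => ?_⟩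
  have h := hL x ⟨hx.1, by linarith [hx.2]⟩ (x + t)
    ⟨add_nonneg hx.1 ht.1, by linarith [hx.2, ht.2]⟩
  rwa [sub_add_cancel_left, abs_neg, abs_of_nonneg ht.1] at h

/-- The integrable majorant of the integrand of the Marchaud derivative. -/
noncomputable def majorant (k M L t : ℝ) : ℝ :=
  if t ≤ 1 then L * t ^ (-k) else 2 * M * t ^ (-1 - k)

theorem integrableOn_majorant {k : ℝ} (hk0 : 0 < k) (hk1 : k < 1) (M L : ℝ) :
    IntegrableOn (majorant k M L) (Ioi 0) := by
  rw [← Ioc_union_Ioi_eq_Ioi zero_le_one]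
  refine IntegrableOn.union ?_ ?_
  · have h := ((intervalIntegrable_rpow_neg hk1 0 1).const_mul L).1
    refine h.congr_fun (fun t ht => ?_) measurableSet_Ioc
    simp [majorant, ht.2]
  · have h := (integrableOn_Ioi_rpow_of_lt (by linarith : -1 - k < -1) zero_lt_one).const_mul
      (2 * M)
    refine IntegrableOn.congr_fun h (fun t ht => ?_) measurableSet_Ioi
    simp [majorant, not_le.2 (mem_Ioi.1 ht)]

theorem abs_integrand_le_majorant {k M L : ℝ} {f : ℝ → ℝ} (hM : ∀ x, 0 ≤ x → |f x| ≤ M)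
    {x : ℝ} (hx : 0 ≤ x) (hL : ∀ t ∈ Icc (0 : ℝ) 1, |f x - f (x + t)| ≤ L * t) {t : ℝ}
    (ht : 0 < t) : |(f x - f (x + t)) / t ^ (1 + k)| ≤ majorant k M L t := by
  have e1 : t ^ (-k) = t / t ^ (1 + k) := by
    rw [Real.rpow_neg ht.le, Real.rpow_add ht, Real.rpow_one]
    field_simp
  have e2 : t ^ (-1 - k) = 1 / t ^ (1 + k) := by
    rw [one_div, ← Real.rpow_neg ht.le]; ring_nf
  rw [abs_div, abs_of_pos (Real.rpow_pos_of_pos ht (1 + k)), majorant]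
  split_ifs with h
  · rw [e1, ← mul_div_assoc]
    gcongr
    exact hL t ⟨ht.le, h⟩
  · rw [e2, mul_one_div]
    gcongr
    calc |f x - f (x + t)| ≤ |f x| + |f (x + t)| := abs_sub _ _
      _ ≤ 2 * M := by linarith [hM x hx, hM (x + t) (by linarith)]

theorem Tame.aestronglyMeasurable {M : ℝ} {f : ℝ → ℝ} (hf : Tame M f) (k : ℝ) {x : ℝ}
    (hx : 0 ≤ x) : AEStronglyMeasurable (fun t => (f x - f (x + t)) / t ^ (1 + k))
      (volume.restrict (Ioi 0)) := by
  refine ContinuousOn.aestronglyMeasurable ?_ measurableSet_Ioi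
  refine ContinuousOn.div (continuousOn_const.sub (hf.continuousOn.comp (by fun_prop) ?_)) ?_ ?_
  · intro t ht; exact add_nonneg hx (mem_Ioi.1 ht).le
  · intro t ht
    exact (Real.continuousAt_rpow_const _ _ (Or.inl (ne_of_gt ht))).continuousWithinAt
  · intro t ht
    exact (Real.rpow_pos_of_pos ht _).ne'

theorem Tame.integrableOn {M : ℝ} {f : ℝ → ℝ} (hf : Tame M f) {k : ℝ} (hk0 : 0 < k)
    (hk1 : k < 1) {x : ℝ} (hx : 0 ≤ x) :
    IntegrableOn (fun t => (f x - f (x + t)) / t ^ (1 + k)) (Ioi 0) := by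
  obtain ⟨L, hL⟩ := hf.exists_step x
  refine Integrable.mono' (integrableOn_majorant hk0 hk1 M L) (hf.aestronglyMeasurable k hx) ?_
  filter_upwards [ae_restrict_mem measurableSet_Ioi] with t ht
  exact abs_integrand_le_majorant hf.abs_le hx (hL x ⟨hx, le_rfl⟩) ht

theorem Tame.marchaudExists {M : ℝ} {f : ℝ → ℝ} (hf : Tame M f) {k : ℝ} (hk0 : 0 < k)
    (hk1 : k < 1) {x : ℝ} (hx : 0 ≤ x) : MarchaudExists k f x := by
  have := hf.integrableOn hk0 hk1 hx
  simp only [← marchaudIntegrand_eq hk1] at this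
  exact this

/-- Dominated convergence. Continuity makes the essential supremum control every value, in
particular the value at `0`, where the extremal functions are tested. -/
theorem Tame.continuousOn_marchaud {M : ℝ} {f : ℝ → ℝ} (hf : Tame M f) {k : ℝ} (hk0 : 0 < k)
    (hk1 : k < 1) : ContinuousOn (marchaud k f) (Ici 0) := by
  have : marchaud k f = fun x => (1 / kappa k (diffOrder k)) *
      ∫ t in Ioi (0 : ℝ), (f x - f (x + t)) / t ^ (1 + k) := funext (marchaud_eq hk1 f)
  rw [this]
  refine continuousOn_const.mul ?_
  intro x hx
  -- One Lipschitz constant must serve all base points near `x`, so that the majorant does not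
  -- depend on them.
  obtain ⟨L, hL⟩ := hf.exists_step (x + 1)
  refine continuousWithinAt_of_dominated (bound := majorant k M L) ?_ ?_
    (integrableOn_majorant hk0 hk1 M L) ?_
  · filter_upwards [self_mem_nhdsWithin] with y hy
    exact hf.aestronglyMeasurable k hy
  · filter_upwards [self_mem_nhdsWithin, nhdsWithin_le_nhds (Iic_mem_nhds (lt_add_one x))]
      with y hy hy1
    filter_upwards [ae_restrict_mem measurableSet_Ioi] with t ht
    exact abs_integrand_le_majorant hf.abs_le hy (hL y ⟨hy, hy1⟩) ht
  · filter_upwards [ae_restrict_mem measurableSet_Ioi] with t ht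
    refine ContinuousWithinAt.div_const ((hf.continuousOn x hx).sub ?_) _
    refine ContinuousWithinAt.comp (t := Ici 0) (hf.continuousOn _ ?_) (by fun_prop) ?_
    · exact add_nonneg hx (mem_Ioi.1 ht).le
    · intro y hy; exact add_nonneg hy (mem_Ioi.1 ht).le

/-! ### Pointwise values and the essential supremum -/

theorem memLp_top_of_continuousOn {G : ℝ → ℝ} (hG : ContinuousOn G (Ici 0)) {B : ℝ}
    (hB : ∀ x, 0 ≤ x → |G x| ≤ B) : MemLp G ⊤ mu :=
  memLp_top_of_bound (hG.aestronglyMeasurable measurableSet_Ici) B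
    (ae_restrict_of_forall_mem measurableSet_Ici hB)

theorem norm_top_le {G : ℝ → ℝ} {B : ℝ} (hB : ∀ x, 0 ≤ x → |G x| ≤ B) : norm ⊤ G ≤ B := by
  have h0 : 0 ≤ B := (abs_nonneg _).trans (hB 0 le_rfl)
  rw [norm, eLpNorm_exponent_top]
  refine ENNReal.toReal_le_of_le_ofReal h0 (eLpNormEssSup_le_of_ae_bound ?_)
  exact ae_restrict_of_forall_mem measurableSet_Ici hB

/-- By continuity a violation at `x` would persist on some interval `(x, u)`, which has positive
measure. The right-hand side is used because `x` may be `0`. -/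
theorem abs_le_norm_top {G : ℝ → ℝ} (hG : ContinuousOn G (Ici 0)) (hm : MemLp G ⊤ mu) {x : ℝ}
    (hx : 0 ≤ x) : |G x| ≤ norm ⊤ G := by
  by_contra! hc
  have hae : ∀ᵐ y ∂mu, |G y| ≤ norm ⊤ G := by
    filter_upwards [ae_le_eLpNormEssSup (f := G) (μ := mu)] with y hy
    rw [norm, eLpNorm_exponent_top, ← Real.norm_eq_abs, ← toReal_enorm]
    refine ENNReal.toReal_mono ?_ hy
    have := hm.eLpNorm_ne_top
    rwa [eLpNorm_exponent_top] at this
  have hev : ∀ᶠ y in 𝓝[Ici 0] x, norm ⊤ G < |G y| :=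
    (hG x hx).abs.eventually (lt_mem_nhds hc)
  have hev2 : ∀ᶠ y in 𝓝[>] x, norm ⊤ G < |G y| :=
    hev.filter_mono (nhdsWithin_mono _ fun y hy => hx.trans (le_of_lt hy))
  obtain ⟨u, hu, hsub⟩ := mem_nhdsGT_iff_exists_Ioo_subset.1 hev2
  have h0 : mu (Ioo x u) = 0 := by
    refine measure_mono_null (fun y hy => ?_) (ae_iff.1 hae)
    exact not_le.2 (hsub hy)
  rw [mu, Measure.restrict_apply measurableSet_Ioo, inter_eq_left.2, Real.volume_Ioo] at h0
  · have := ENNReal.ofReal_eq_zero.1 h0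
    linarith [mem_Ioi.1 hu]
  · intro y hy; exact hx.trans hy.1.le

/-! ### Regularity of functions in the space -/

theorem MemL2.hasDerivWithinAt {s : ℝ≥0∞} {f : ℝ → ℝ} (hf : MemL2 s f) {x : ℝ} (hx : 0 ≤ x) :
    HasDerivWithinAt f (deriv1 f x) (Ici 0) x :=
  (hf.differentiableOn x hx).hasDerivWithinAt

/-- An absolutely continuous `f'` is bounded on `[0, b]`, so the mean value inequality gives the
Lipschitz bound. -/
theorem MemL2.tame {s : ℝ≥0∞} {f : ℝ → ℝ} (hf : MemL2 s f) : Tame (norm ⊤ f) f where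
  continuousOn := hf.differentiableOn.continuousOn
  abs_le _ hx := abs_le_norm_top hf.differentiableOn.continuousOn hf.memLp hx
  lipschitz b := by
    rcases lt_or_ge b 0 with hb | hb
    · exact ⟨0, fun x hx => absurd (hx.1.trans hx.2) (not_le.2 hb)⟩
    obtain ⟨L, hL⟩ := (hf.absolutelyContinuous b hb).exists_bound
    rw [uIcc_of_le hb] at hL
    refine ⟨L, fun x hx y hy => ?_⟩
    exact Convex.norm_image_sub_le_of_norm_hasDerivWithin_le
      (fun z hz => (hf.hasDerivWithinAt hz.1).mono Icc_subset_Ici_self) hL (convex_Icc 0 b) hy hx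

theorem deriv2_eq_deriv {f : ℝ → ℝ} {x : ℝ} (hx : 0 < x) : deriv2 f x = deriv (deriv1 f) x :=
  derivWithin_of_mem_nhds (Ici_mem_nhds hx)

theorem MemL2.integral_deriv2 {s : ℝ≥0∞} {f : ℝ → ℝ} (hf : MemL2 s f) {x y : ℝ} (hx : 0 ≤ x)
    (hxy : x ≤ y) : ∫ t in x..y, deriv2 f t = deriv1 f y - deriv1 f x := by
  have hac : AbsolutelyContinuousOnInterval (deriv1 f) x y := by
    refine (hf.absolutelyContinuous y (hx.trans hxy)).mono ?_
    rw [uIcc_of_le hxy, uIcc_of_le (hx.trans hxy)]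
    exact Icc_subset_Icc_left hx
  rw [← hac.integral_deriv_eq_sub]
  refine intervalIntegral.integral_congr_ae (ae_of_all _ fun t ht => deriv2_eq_deriv ?_)
  rw [uIoc_of_le hxy] at ht
  exact hx.trans_lt ht.1

/-! ### Rescaling and the integral identity -/

/-- Only an inequality: the image of the half-line is `[x, ∞)`, and the mass on `[0, x)` is lost. -/
theorem map_affine_mu_le {x h : ℝ} (hx : 0 ≤ x) (hh : 0 < h) :
    Measure.map (fun u => x + h * u) mu ≤ ENNReal.ofReal h⁻¹ • mu := by
  have hT : Measurable fun u : ℝ => x + h * u := by fun_prop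
  have hmap : Measure.map (fun u : ℝ => x + h * u) volume = ENNReal.ofReal h⁻¹ • volume := by
    have : (fun u : ℝ => x + h * u) = (fun u => x + u) ∘ fun u => h * u := rfl
    rw [this, ← Measure.map_map (by fun_prop) (by fun_prop), Real.map_volume_mul_left hh.ne',
      Measure.map_smul, map_add_left_eq_self, abs_of_pos (inv_pos.2 hh)]
  calc Measure.map (fun u => x + h * u) mu
      ≤ Measure.map (fun u => x + h * u)
          (volume.restrict ((fun u => x + h * u) ⁻¹' Ici 0)) := by
        refine Measure.map_mono (Measure.restrict_mono (fun u hu => ?_) le_rfl) hT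
        exact add_nonneg hx (mul_nonneg hh.le hu)
    _ = ENNReal.ofReal h⁻¹ • mu := by
        rw [← Measure.restrict_map hT measurableSet_Ici, hmap, Measure.restrict_smul, mu]

theorem memLp_comp_affine {s : ℝ≥0∞} {g : ℝ → ℝ} (hg : MemLp g s mu) {x h : ℝ} (hx : 0 ≤ x)
    (hh : 0 < h) : MemLp (fun u => g (x + h * u)) s mu ∧
      norm s (fun u => g (x + h * u)) ≤ h⁻¹ ^ (1 / s).toReal * norm s g := by
  have hT : AEMeasurable (fun u : ℝ => x + h * u) mu := by fun_prop
  have hle := map_affine_mu_le hx hh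
  have hc : MemLp g s (ENNReal.ofReal h⁻¹ • mu) := hg.smul_measure ENNReal.ofReal_ne_top
  have hm := hc.mono_measure hle
  refine ⟨hm.comp_of_map hT, ?_⟩
  have e : eLpNorm (fun u => g (x + h * u)) s mu = eLpNorm g s (Measure.map _ mu) :=
    (eLpNorm_map_measure hm.1 hT).symm
  rw [norm, norm, e, ← ENNReal.toReal_ofReal (Real.rpow_nonneg (inv_nonneg.2 hh.le) _),
    ← ENNReal.toReal_mul]
  refine ENNReal.toReal_mono (ENNReal.mul_ne_top ENNReal.ofReal_ne_top hg.eLpNorm_ne_top) ?_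
  refine (eLpNorm_mono_measure _ hle).trans ?_
  rw [eLpNorm_smul_measure_of_ne_zero (by simpa using hh),
    ENNReal.ofReal_rpow_of_pos (inv_pos.2 hh), smul_eq_mul]

theorem intervalIntegrable_of_memLp {s : ℝ≥0∞} (hs : 1 ≤ s) {w : ℝ → ℝ}
    (hw : MemLp w s mu) : IntervalIntegrable w volume 0 1 := by
  rw [intervalIntegrable_iff_integrableOn_Ioc_of_le zero_le_one]
  have : MemLp w s (volume.restrict (Ioc 0 1)) :=
    hw.mono_measure (Measure.restrict_mono (fun x hx => hx.1.le) le_rfl)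
  exact this.integrable hs

/-- The Marchaud integral of `f` at `x`, with the part over `[0, h]` expressed by `f''`. -/
theorem MemL2.integral_eq {s : ℝ≥0∞} (hs : 1 ≤ s) {f : ℝ → ℝ} (hf : MemL2 s f) {k : ℝ}
    (hk0 : 0 < k) (hk1 : k < 1) {x h : ℝ} (hx : 0 ≤ x) (hh : 0 < h) :
    k * (1 - k) * (h ^ k * ∫ t in Ioi (0 : ℝ), (f x - f (x + t)) / t ^ (1 + k)) =
      (∫ u in (0 : ℝ)..1, (u ^ (1 - k) - u) * (h ^ 2 * deriv2 f (x + h * u))) +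
      k * (f x - f (x + h)) +
      k * (1 - k) * ∫ u in Ioi (1 : ℝ), (f x - f (x + h * u)) / u ^ (1 + k) := by
  have hG := hf.tame.integrableOn hk0 hk1 hx
  have hhk : (0 : ℝ) < h ^ (1 + k) := Real.rpow_pos_of_pos hh _
  -- The substitution `t = h u`.
  have hcomp : EqOn (fun u => h ^ (1 + k) * ((f x - f (x + h * u)) / (h * u) ^ (1 + k)))
      (fun u => (f x - f (x + h * u)) / u ^ (1 + k)) (Ioi 0) := by
    intro u hu
    have hu' : (0 : ℝ) < u ^ (1 + k) := Real.rpow_pos_of_pos hu _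
    simp only
    rw [Real.mul_rpow hh.le (mem_Ioi.1 hu).le]
    field_simp
  have hint : IntegrableOn (fun u => (f x - f (x + h * u)) / u ^ (1 + k)) (Ioi 0) := by
    have h1 := (integrableOn_Ioi_comp_mul_left_iff
      (fun t => (f x - f (x + t)) / t ^ (1 + k)) 0 hh).2 (by simpa using hG)
    exact IntegrableOn.congr_fun (h1.const_mul (h ^ (1 + k))) hcomp measurableSet_Ioi
  have e1 : h ^ k * ∫ t in Ioi (0 : ℝ), (f x - f (x + t)) / t ^ (1 + k) =
      ∫ u in Ioi (0 : ℝ), (f x - f (x + h * u)) / u ^ (1 + k) := by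
    rw [← setIntegral_congr_fun measurableSet_Ioi hcomp, integral_const_mul,
      integral_comp_mul_left_Ioi (fun t => (f x - f (x + t)) / t ^ (1 + k)) 0 hh, mul_zero,
      smul_eq_mul, ← mul_assoc, Real.rpow_add hh, Real.rpow_one]
    field_simp
  have hint1 : IntegrableOn (fun u => (f x - f (x + h * u)) / u ^ (1 + k)) (Ioi 1) :=
    hint.mono_set (Ioi_subset_Ioi zero_le_one)
  have hint0 : IntegrableOn (fun u => (f x - f (x + h * u)) / u ^ (1 + k)) (Ioc 0 1) :=
    hint.mono_set Ioc_subset_Ioi_self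
  rw [e1, ← Ioc_union_Ioi_eq_Ioi (zero_le_one' ℝ),
    setIntegral_union (Ioc_disjoint_Ioi le_rfl) measurableSet_Ioi hint0 hint1, mul_add,
    ← intervalIntegral.integral_of_le zero_le_one]
  congr 1
  have hT : ∀ u ∈ Icc (0 : ℝ) 1, x + h * u ∈ Icc 0 (x + h) := fun u hu =>
    ⟨add_nonneg hx (mul_nonneg hh.le hu.1), by nlinarith [hu.2]⟩
  obtain ⟨L, hL⟩ := hf.tame.lipschitz (x + h)
  have key := integral_difference_zero_one hk1 (F := fun u => f (x + h * u))
    (F1 := fun u => h * deriv1 f (x + h * u)) (w := fun u => h ^ 2 * deriv2 f (x + h * u))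
    (L := L * h) ?_ ?_ ?_ ?_ ?_ ?_
  · simpa using key
  · exact (intervalIntegrable_of_memLp hs (memLp_comp_affine hf.memLp_deriv2 hx hh).1).const_mul _
  · intro u hu
    have hxu : x ≤ x + h * u := by nlinarith [mul_nonneg hh.le hu.1]
    have h1 := hf.integral_deriv2 hx hxu
    have h2 := intervalIntegral.integral_comp_add_mul (a := 0) (b := u) (deriv2 f) hh.ne' x
    rw [mul_zero, add_zero, h1, smul_eq_mul] at h2
    simp only [intervalIntegral.integral_const_mul, h2, mul_zero, add_zero]
    field_simp
    ring
  · exact hf.tame.continuousOn.comp (by fun_prop) fun u hu => (hT u hu).1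
  · intro u hu
    have hpos : 0 < x + h * u := add_pos_of_nonneg_of_pos hx (mul_pos hh hu.1)
    have h1 := (hf.hasDerivWithinAt hpos.le).hasDerivAt (Ici_mem_nhds hpos)
    have h2 : HasDerivAt (fun u => x + h * u) h u := by
      simpa using ((hasDerivAt_id u).const_mul h).const_add x
    have h3 := h1.comp u h2
    rwa [mul_comm] at h3
  · rw [intervalIntegrable_iff_integrableOn_Ioc_of_le zero_le_one]
    simpa using hint0
  · intro t ht
    have h1 := hL x ⟨hx, by linarith⟩ _ (hT t ht)
    rw [sub_add_cancel_left, abs_neg, abs_of_nonneg (mul_nonneg hh.le ht.1)] at h1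
    simpa [mul_assoc] using h1

theorem integral_Ioi_one_rpow {k : ℝ} (hk0 : 0 < k) :
    IntegrableOn (fun u : ℝ => 1 / u ^ (1 + k)) (Ioi 1) ∧
      ∫ u in Ioi (1 : ℝ), 1 / u ^ (1 + k) = 1 / k := by
  have he : EqOn (fun u : ℝ => u ^ (-1 - k)) (fun u => 1 / u ^ (1 + k)) (Ioi 1) := by
    intro u hu
    have : (0 : ℝ) ≤ u := zero_le_one.trans (mem_Ioi.1 hu).le
    simp only
    rw [one_div, ← Real.rpow_neg this]
    ring_nf
  refine ⟨(integrableOn_Ioi_rpow_of_lt (by linarith) zero_lt_one).congr_fun he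
    measurableSet_Ioi, ?_⟩
  rw [← setIntegral_congr_fun measurableSet_Ioi he,
    integral_Ioi_rpow_of_lt (by linarith) zero_lt_one, Real.one_rpow]
  have : -1 - k + 1 = -k := by ring
  rw [this, neg_div_neg_eq]

/-! ### The additive inequality -/

theorem norm_const_mul {s : ℝ≥0∞} {c : ℝ} (hc : 0 ≤ c) (g : ℝ → ℝ) :
    norm s (fun x => c * g x) = c * norm s g := by
  have : (fun x => c * g x) = c • g := rfl
  rw [norm, this, eLpNorm_const_smul, ENNReal.toReal_mul, toReal_enorm, Real.norm_of_nonneg hc,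
    norm]

/-- `N` bounds the functional `w ↦ ∫ (t ^ (1 - k) - t) w t`, `0 ≤ t ≤ 1`, on `L_s`. -/
def KernelBound (k : ℝ) (s : ℝ≥0∞) (N : ℝ) : Prop :=
  ∀ w : ℝ → ℝ, MemLp w s mu → |∫ u in (0 : ℝ)..1, (u ^ (1 - k) - u) * w u| ≤ N * norm s w

/-- The difference at `h` costs `k · 2‖f‖_∞` and the tail `(1 - k) · 2‖f‖_∞`, in total `2‖f‖_∞`. The
exponent `2 - 1/s` combines the factor `h²` with the scaling `h ^ (-1/s)` of the `L_s` norm. -/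
theorem MemL2.abs_integral_le {s : ℝ≥0∞} (hs : 1 ≤ s) {f : ℝ → ℝ} (hf : MemL2 s f) {k : ℝ}
    (hk0 : 0 < k) (hk1 : k < 1) {N : ℝ} (hN0 : 0 ≤ N) (hN : KernelBound k s N) {x h : ℝ}
    (hx : 0 ≤ x) (hh : 0 < h) :
    k * (1 - k) * |∫ t in Ioi (0 : ℝ), (f x - f (x + t)) / t ^ (1 + k)| * h ^ k ≤
      2 * norm ⊤ f + N * (h ^ (2 - (1 / s).toReal) * norm s (deriv2 f)) := by
  have heq := hf.integral_eq hs hk0 hk1 hx hh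
  obtain ⟨hwm, hwn⟩ := memLp_comp_affine hf.memLp_deriv2 hx hh
  have hk : 0 < k * (1 - k) := mul_pos hk0 (by linarith)
  have hhk : (0 : ℝ) < h ^ k := Real.rpow_pos_of_pos hh _
  have hM : ∀ y, 0 ≤ y → |f x - f y| ≤ 2 * norm ⊤ f := fun y hy =>
    (abs_sub _ _).trans (by linarith [hf.tame.abs_le x hx, hf.tame.abs_le y hy])
  have b1 : |∫ u in (0 : ℝ)..1, (u ^ (1 - k) - u) * (h ^ 2 * deriv2 f (x + h * u))| ≤
      N * (h ^ (2 - (1 / s).toReal) * norm s (deriv2 f)) := by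
    refine (hN _ (hwm.const_mul (h ^ 2))).trans ?_
    rw [norm_const_mul (by positivity)]
    refine mul_le_mul_of_nonneg_left ?_ hN0
    refine (mul_le_mul_of_nonneg_left hwn (by positivity)).trans (le_of_eq ?_)
    rw [← mul_assoc, Real.inv_rpow hh.le, ← Real.rpow_neg hh.le, ← Real.rpow_two,
      ← Real.rpow_add hh, sub_eq_add_neg]
  have b2 := hM (x + h) (by linarith)
  have b3 : |∫ u in Ioi (1 : ℝ), (f x - f (x + h * u)) / u ^ (1 + k)| ≤ 2 * norm ⊤ f / k := by
    obtain ⟨hi, hv⟩ := integral_Ioi_one_rpow hk0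
    have h1 := norm_integral_le_of_norm_le (hi.const_mul (2 * norm ⊤ f))
      (f := fun u => (f x - f (x + h * u)) / u ^ (1 + k)) ?_
    · rwa [integral_const_mul, hv, mul_one_div] at h1
    · filter_upwards [ae_restrict_mem measurableSet_Ioi] with u hu
      have hu0 : 0 < u := zero_lt_one.trans hu
      rw [norm_div, Real.norm_eq_abs, Real.norm_of_nonneg (Real.rpow_nonneg hu0.le _), mul_one_div]
      gcongr
      exact hM _ (add_nonneg hx (mul_pos hh hu0).le)
  have habs : k * (1 - k) * |∫ t in Ioi (0 : ℝ), (f x - f (x + t)) / t ^ (1 + k)| * h ^ k =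
      |k * (1 - k) * (h ^ k * ∫ t in Ioi (0 : ℝ), (f x - f (x + t)) / t ^ (1 + k))| := by
    rw [abs_mul (k * (1 - k)), abs_mul (h ^ k), abs_of_pos hk, abs_of_pos hhk]; ring
  rw [habs, heq]
  refine (abs_add_three _ _ _).trans ?_
  rw [abs_mul k, abs_mul (k * (1 - k)), abs_of_pos hk, abs_of_pos hk0]
  have c2 := mul_le_mul_of_nonneg_left b2 hk0.le
  have c3 := mul_le_mul_of_nonneg_left b3 hk.le
  have c3' : k * (1 - k) * (2 * norm ⊤ f / k) = (1 - k) * (2 * norm ⊤ f) := by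
    field_simp
  linarith

/-! ### From the additive to the multiplicative inequality -/

theorem le_of_forall_scale_of_pos {A a b N M k m : ℝ} (hk0 : 0 < k) (hkm : k < m) (hM : 0 < M)
    (ha : 0 < a) (hb : 0 < b) (h : ∀ h : ℝ, 0 < h → A * h ^ k ≤ 2 * a + N * (h ^ m * b)) :
    A ≤ (2 * M + N) / M ^ (1 - k / m) * a ^ (1 - k / m) * b ^ (k / m) := by
  have hm : 0 < m := hk0.trans hkm
  -- The step is `r ^ (1 / m)`, so that `h ^ m * b = a / M` and the right-hand side becomes `(2 M +
  -- N) (a / M)`. No minimization over `h` is needed: sharpness will come from the choice of `M`.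
  set r := a / M / b with hr
  have hr0 : 0 < r := by positivity
  have h1 := h (r ^ (1 / m)) (Real.rpow_pos_of_pos hr0 _)
  rw [← Real.rpow_mul hr0.le, ← Real.rpow_mul hr0.le, one_div_mul_cancel hm.ne', Real.rpow_one,
    one_div_mul_eq_div, ← le_div_iff₀ (Real.rpow_pos_of_pos hr0 _)] at h1
  refine h1.trans (le_of_eq ?_)
  have haM : 0 < a / M := by positivity
  have e1 : r ^ (k / m) = (a / M) ^ (k / m) / b ^ (k / m) := Real.div_rpow haM.le hb.le _
  have e2 : (2 * M + N) / M ^ (1 - k / m) * a ^ (1 - k / m) * b ^ (k / m) =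
      (2 * M + N) * (a / M) ^ (1 - k / m) * b ^ (k / m) := by
    rw [Real.div_rpow ha.le hM.le]; ring
  rw [e2, e1, Real.rpow_sub haM, Real.rpow_one, hr]
  have := Real.rpow_pos_of_pos haM (k / m)
  have := Real.rpow_pos_of_pos hb (k / m)
  field_simp

/-- Vanishing `a` or `b` is reached by applying the positive case to `a + ε` and `b + ε` and letting
`ε` tend to `0`; both exponents are positive, so the bound is continuous. -/
theorem le_of_forall_scale {A a b N M k m : ℝ} (hk0 : 0 < k) (hkm : k < m) (hN : 0 ≤ N)
    (hM : 0 < M) (ha : 0 ≤ a) (hb : 0 ≤ b)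
    (h : ∀ h : ℝ, 0 < h → A * h ^ k ≤ 2 * a + N * (h ^ m * b)) :
    A ≤ (2 * M + N) / M ^ (1 - k / m) * a ^ (1 - k / m) * b ^ (k / m) := by
  have hm : 0 < m := hk0.trans hkm
  have hlam : 0 < k / m := div_pos hk0 hm
  have hlam1 : 0 < 1 - k / m := sub_pos.2 ((div_lt_one hm).2 hkm)
  have hc : Continuous fun ε : ℝ =>
      (2 * M + N) / M ^ (1 - k / m) * (a + ε) ^ (1 - k / m) * (b + ε) ^ (k / m) :=
    (continuous_const.mul ((Real.continuous_rpow_const hlam1.le).comp (by fun_prop))).mul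
      ((Real.continuous_rpow_const hlam.le).comp (by fun_prop))
  have ht := (hc.tendsto 0).mono_left (nhdsWithin_le_nhds (s := Ioi 0))
  simp only [add_zero] at ht
  refine ge_of_tendsto ht ?_
  filter_upwards [self_mem_nhdsWithin] with ε hε
  have hε : (0 : ℝ) < ε := hε
  refine le_of_forall_scale_of_pos hk0 hkm hM (by linarith) (by linarith) fun t ht => ?_
  refine (h t ht).trans ?_
  have : 0 < t ^ m := Real.rpow_pos_of_pos ht m
  gcongr <;> linarith

theorem norm_real_nonneg (p : ℝ≥0∞) (f : ℝ → ℝ) : 0 ≤ norm p f := ENNReal.toReal_nonneg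

theorem one_le_exponent {s : ℝ≥0∞} (hs : 1 ≤ s) : 1 ≤ 2 - (1 / s).toReal := by
  have h : (1 / s).toReal ≤ 1 := by
    refine ENNReal.toReal_le_of_le_ofReal zero_le_one ?_
    simpa using hs
  linarith

/-- The factor `k / Γ(1 - k)` of the Marchaud derivative over `k (1 - k)`. -/
noncomputable def marchaudConst (k : ℝ) : ℝ := 1 / kappa k (diffOrder k) / (k * (1 - k))

theorem marchaudConst_pos {k : ℝ} (hk0 : 0 < k) (hk1 : k < 1) : 0 < marchaudConst k :=
  div_pos (one_div_pos.2 (kappa_pos hk0 hk1)) (mul_pos hk0 (by linarith))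

theorem marchaud_eq_const_mul {k : ℝ} (hk0 : 0 < k) (hk1 : k < 1) (f : ℝ → ℝ) (x : ℝ) :
    marchaud k f x = marchaudConst k *
      (k * (1 - k) * ∫ t in Ioi (0 : ℝ), (f x - f (x + t)) / t ^ (1 + k)) := by
  have : k * (1 - k) ≠ 0 := (mul_pos hk0 (by linarith)).ne'
  rw [marchaud_eq hk1, ← mul_assoc, marchaudConst, div_mul_cancel₀ _ this]

/-- `M` stays free: any value proves boundedness, and the norm of the extremal function gives the
sharp constant. -/
theorem MemL2.abs_marchaud_le {s : ℝ≥0∞} (hs : 1 ≤ s) {f : ℝ → ℝ} (hf : MemL2 s f) {k : ℝ}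
    (hk0 : 0 < k) (hk1 : k < 1) {N : ℝ} (hN0 : 0 ≤ N) (hN : KernelBound k s N) {M : ℝ}
    (hM : 0 < M) {x : ℝ} (hx : 0 ≤ x) :
    |marchaud k f x| ≤ marchaudConst k * (2 * M + N) / M ^ (1 - lam k s) *
      norm ⊤ f ^ (1 - lam k s) * norm s (deriv2 f) ^ lam k s := by
  have hk : 0 < k * (1 - k) := mul_pos hk0 (by linarith)
  have h := le_of_forall_scale (m := 2 - (1 / s).toReal) hk0 (hk1.trans_le (one_le_exponent hs))
    hN0 hM (norm_real_nonneg ⊤ f) (norm_real_nonneg s (deriv2 f))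
    fun h hh => hf.abs_integral_le hs hk0 hk1 hN0 hN hx hh
  rw [marchaud_eq_const_mul hk0 hk1, abs_mul, abs_mul, abs_of_pos hk,
    abs_of_pos (marchaudConst_pos hk0 hk1)]
  refine (mul_le_mul_of_nonneg_left h (marchaudConst_pos hk0 hk1).le).trans (le_of_eq ?_)
  rw [lam]
  ring

/-! ### Functions with prescribed second derivative -/

/-- A bounded nonnegative function carried by `(0, 1)`. -/
structure Density (B : ℝ) (g : ℝ → ℝ) : Prop where
  measurable : Measurable g
  nonneg : ∀ t, 0 ≤ g t
  le : ∀ t, g t ≤ B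
  eq_zero : ∀ t, t ∉ Ioo (0 : ℝ) 1 → g t = 0

/-- The function with second derivative `g` that is constant on `[1, ∞)` and takes opposite
values at `0` and `1`. -/
noncomputable def profile (g : ℝ → ℝ) (x : ℝ) : ℝ :=
  (∫ t in (0 : ℝ)..1, (-x + t / 2) * g t) + ∫ t in (0 : ℝ)..x, (x - t) * g t

namespace Density

variable {B : ℝ} {g : ℝ → ℝ} (hg : Density B g)
include hg

theorem norm_le (t : ℝ) : ‖g t‖ ≤ B := by
  rw [Real.norm_of_nonneg (hg.nonneg t)]; exact hg.le t

theorem bound_nonneg : 0 ≤ B := (hg.nonneg 0).trans (hg.le 0)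

theorem intervalIntegrable (a b : ℝ) : IntervalIntegrable g volume a b :=
  (intervalIntegrable_const (c := B)).mono_fun hg.measurable.aestronglyMeasurable
    (ae_of_all _ fun t => (hg.norm_le t).trans (le_abs_self _))

theorem locallyIntegrable : LocallyIntegrable g volume := by
  refine (locallyIntegrable_const B).mono hg.measurable.aestronglyMeasurable
    (ae_of_all _ fun t => (hg.norm_le t).trans (le_abs_self _))

theorem memLp (s : ℝ≥0∞) : MemLp g s mu := by
  have hind : g = (Ioo (0 : ℝ) 1).indicator g := by
    ext t
    by_cases ht : t ∈ Ioo (0 : ℝ) 1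
    · rw [indicator_of_mem ht]
    · rw [indicator_of_notMem ht, hg.eq_zero t ht]
  have h : MemLp g s (volume.restrict (Ioo 0 1)) :=
    MemLp.of_bound hg.measurable.aestronglyMeasurable B (ae_of_all _ hg.norm_le)
  have h2 : MemLp g s volume := by
    rw [hind, memLp_indicator_iff_restrict measurableSet_Ioo]
    exact h
  exact h2.restrict _

theorem primitive_lipschitz (x y : ℝ) :
    |(∫ t in (0 : ℝ)..x, g t) - ∫ t in (0 : ℝ)..y, g t| ≤ B * |x - y| := by
  rw [intervalIntegral.integral_interval_sub_left (hg.intervalIntegrable _ _)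
    (hg.intervalIntegrable _ _)]
  exact intervalIntegral.norm_integral_le_of_norm_le_const fun t _ => hg.norm_le t

theorem continuous_primitive : Continuous fun x => ∫ t in (0 : ℝ)..x, g t :=
  intervalIntegral.continuous_primitive hg.intervalIntegrable 0

/-- Integration by parts replaces the kernel `x - t`, which depends on `x`, by an iterated primitive
that the fundamental theorem of calculus can differentiate. -/
theorem integral_sub_mul (x : ℝ) :
    ∫ t in (0 : ℝ)..x, (x - t) * g t = ∫ u in (0 : ℝ)..x, ∫ t in (0 : ℝ)..u, g t := by
  have hA : AbsolutelyContinuousOnInterval (fun u => ∫ t in (0 : ℝ)..u, g t) 0 x :=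
    (hg.intervalIntegrable 0 x).absolutelyContinuousOnInterval_intervalIntegral (by simp)
  have hl : AbsolutelyContinuousOnInterval (fun t => x - t) 0 x :=
    (LipschitzOnWith.absolutelyContinuousOnInterval (K := 1)
      (LipschitzOnWith.of_dist_le_mul fun a _ b _ => by rw [dist_sub_left]; simp))
  have key := hl.integral_mul_deriv_eq_deriv_mul hA
  have e1 : ∫ t in (0 : ℝ)..x, (x - t) * deriv (fun u => ∫ t in (0 : ℝ)..u, g t) t =
      ∫ t in (0 : ℝ)..x, (x - t) * g t := by
    apply intervalIntegral.integral_congr_ae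
    filter_upwards [LocallyIntegrable.ae_hasDerivAt_integral hg.locallyIntegrable] with t ht _
    rw [(ht 0).deriv]
  have e2 : deriv (fun t => x - t) = fun _ => (-1 : ℝ) := by
    ext t
    simp
  rw [e1, e2] at key
  simpa using key

theorem profile_eq (x : ℝ) : profile g x =
    -x * (∫ t in (0 : ℝ)..1, g t) + (∫ t in (0 : ℝ)..1, t * g t) / 2 +
      ∫ u in (0 : ℝ)..x, ∫ t in (0 : ℝ)..u, g t := by
  rw [profile, hg.integral_sub_mul]
  congr 1
  have : ∀ t, (-x + t / 2) * g t = -x * g t + 1 / 2 * (t * g t) := fun t => by ring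
  have hi2 : IntervalIntegrable (fun t => t * g t) volume 0 1 :=
    (hg.intervalIntegrable _ _).continuousOn_mul continuousOn_id
  simp only [this]
  rw [intervalIntegral.integral_add ((hg.intervalIntegrable _ _).const_mul _)
    (hi2.const_mul _),
    intervalIntegral.integral_const_mul, intervalIntegral.integral_const_mul]
  ring

theorem hasDerivAt_profile (x : ℝ) : HasDerivAt (profile g)
    (-(∫ t in (0 : ℝ)..1, g t) + ∫ t in (0 : ℝ)..x, g t) x := by
  rw [show profile g = _ from funext hg.profile_eq]
  have h1 := (((hasDerivAt_id x).neg.mul_const (∫ t in (0 : ℝ)..1, g t)).add_const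
    ((∫ t in (0 : ℝ)..1, t * g t) / 2)).add
    (hg.continuous_primitive.integral_hasStrictDerivAt 0 x).hasDerivAt
  refine h1.congr_deriv ?_
  ring

theorem deriv1_profile {x : ℝ} (hx : 0 ≤ x) :
    deriv1 (profile g) x = -(∫ t in (0 : ℝ)..1, g t) + ∫ t in (0 : ℝ)..x, g t :=
  (hg.hasDerivAt_profile x).hasDerivWithinAt.derivWithin (uniqueDiffOn_Ici 0 x hx)

theorem deriv2_profile : deriv2 (profile g) =ᵐ[mu] g := by
  have h0 : ∀ᵐ x ∂mu, x ≠ 0 := ae_restrict_of_ae (Measure.ae_ne volume 0)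
  filter_upwards [h0, ae_restrict_mem measurableSet_Ici,
    ae_restrict_of_ae (LocallyIntegrable.ae_hasDerivAt_integral hg.locallyIntegrable)] with x hx0 hx hd
  have hpos : 0 < x := lt_of_le_of_ne hx (Ne.symm hx0)
  rw [deriv2_eq_deriv hpos]
  have he : deriv1 (profile g) =ᶠ[𝓝 x]
      fun x => -(∫ t in (0 : ℝ)..1, g t) + ∫ t in (0 : ℝ)..x, g t := by
    filter_upwards [Ici_mem_nhds hpos] with y hy
    exact hg.deriv1_profile hy
  rw [he.deriv_eq, ((hd 0).const_add _).deriv]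

theorem integral_eq_zero {a b : ℝ} (ha : 1 ≤ a) (hab : a ≤ b) : ∫ t in a..b, g t = 0 := by
  rw [intervalIntegral.integral_congr (g := fun _ => (0 : ℝ))]
  · simp
  · intro t ht
    rw [uIcc_of_le hab] at ht
    exact hg.eq_zero t fun h => not_le.2 h.2 (ha.trans ht.1)

theorem primitive_le (x : ℝ) :
    ∫ t in (0 : ℝ)..x, g t ≤ ∫ t in (0 : ℝ)..1, g t := by
  have hi := hg.intervalIntegrable
  rcases le_total x 1 with h | h
  · rw [← intervalIntegral.integral_add_adjacent_intervals (hi 0 x) (hi x 1)]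
    linarith [intervalIntegral.integral_nonneg (μ := volume) h fun t _ => hg.nonneg t]
  · rw [← intervalIntegral.integral_add_adjacent_intervals (hi 0 1) (hi 1 x),
      hg.integral_eq_zero le_rfl h, add_zero]

/-- The derivative at `x` is the integral of `g` up to `x` minus its total integral, hence
nonpositive. The profile therefore falls from its value at `0` to the opposite value at `1`, which
determines its sup norm. -/
theorem antitoneOn_profile : AntitoneOn (profile g) (Ici 0) := by
  refine antitoneOn_of_deriv_nonpos (convex_Ici 0)
    (fun x _ => (hg.hasDerivAt_profile x).continuousAt.continuousWithinAt)
    (fun x _ => (hg.hasDerivAt_profile x).differentiableAt.differentiableWithinAt) ?_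
  intro x hx
  rw [interior_Ici] at hx
  rw [(hg.hasDerivAt_profile x).deriv]
  linarith [hg.primitive_le x]

theorem profile_zero : profile g 0 = (∫ t in (0 : ℝ)..1, t * g t) / 2 := by
  rw [hg.profile_eq]; simp

theorem profile_of_one_le {x : ℝ} (hx : 1 ≤ x) :
    profile g x = -(∫ t in (0 : ℝ)..1, t * g t) / 2 := by
  have hi := hg.intervalIntegrable
  have hi2 : ∀ a b, IntervalIntegrable (fun t => t * g t) volume a b := fun a b =>
    (hi a b).continuousOn_mul continuousOn_id
  have h1 : ∫ t in (0 : ℝ)..x, (x - t) * g t = ∫ t in (0 : ℝ)..1, (x - t) * g t := by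
    have hi3 : ∀ a b, IntervalIntegrable (fun t => (x - t) * g t) volume a b := fun a b =>
      (hi a b).continuousOn_mul (by fun_prop)
    rw [← intervalIntegral.integral_add_adjacent_intervals (hi3 0 1) (hi3 1 x), add_eq_left]
    rw [intervalIntegral.integral_congr (g := fun _ => (0 : ℝ))]
    · simp
    · intro t ht
      rw [uIcc_of_le hx] at ht
      simp [hg.eq_zero t fun h => not_le.2 h.2 ht.1]
  rw [hg.profile_eq, ← hg.integral_sub_mul, h1]
  simp only [sub_mul]
  rw [intervalIntegral.integral_sub ((hi 0 1).const_mul x) (hi2 0 1),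
    intervalIntegral.integral_const_mul]
  ring

theorem abs_profile_le {x : ℝ} (hx : 0 ≤ x) :
    |profile g x| ≤ (∫ t in (0 : ℝ)..1, t * g t) / 2 := by
  rw [abs_le]
  constructor
  · have h := hg.antitoneOn_profile hx (b := max x 1) (mem_Ici.2 (hx.trans (le_max_left _ _)))
      (le_max_left _ _)
    rw [hg.profile_of_one_le (le_max_right _ _)] at h
    linarith
  · have h := hg.antitoneOn_profile self_mem_Ici hx hx
    rwa [hg.profile_zero] at h

theorem continuous_profile : Continuous (profile g) :=
  continuous_iff_continuousAt.2 fun x => (hg.hasDerivAt_profile x).continuousAt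

theorem memLp_profile : MemLp (profile g) ⊤ mu :=
  memLp_top_of_continuousOn hg.continuous_profile.continuousOn fun _ hx => hg.abs_profile_le hx

theorem norm_profile : norm ⊤ (profile g) = (∫ t in (0 : ℝ)..1, t * g t) / 2 := by
  refine le_antisymm (norm_top_le fun _ hx => hg.abs_profile_le hx) ?_
  have h := abs_le_norm_top hg.continuous_profile.continuousOn hg.memLp_profile le_rfl
  rw [hg.profile_zero] at h
  exact (le_abs_self _).trans h

theorem memL2_profile (s : ℝ≥0∞) : MemL2 s (profile g) where
  memLp := hg.memLp_profile
  differentiableOn x _ := (hg.hasDerivAt_profile x).differentiableAt.differentiableWithinAt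
  absolutelyContinuous b hb := by
    refine LipschitzOnWith.absolutelyContinuousOnInterval (K := ⟨B, hg.bound_nonneg⟩)
      (LipschitzOnWith.of_dist_le_mul fun x hx y hy => ?_)
    rw [uIcc_of_le hb] at hx hy
    rw [hg.deriv1_profile hx.1, hg.deriv1_profile hy.1, Real.dist_eq, add_sub_add_left_eq_sub]
    exact hg.primitive_lipschitz x y
  memLp_deriv2 := (hg.memLp s).ae_eq hg.deriv2_profile.symm

theorem norm_deriv2_profile (s : ℝ≥0∞) : norm s (deriv2 (profile g)) = norm s g := by
  rw [norm, norm, eLpNorm_congr_ae hg.deriv2_profile]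

/-- The integral identity with `x = 0`, `h = 1`. With `T = ∫ t g t`, the drop from `0` to any `u ≥
1` is exactly `T = 2‖profile g‖_∞`, so the two terms without `f''` add up to `k T + (1 - k) T = T`,
with no loss in their estimate. -/
theorem marchaud_profile_zero {k : ℝ} (hk0 : 0 < k) (hk1 : k < 1) :
    marchaud k (profile g) 0 = marchaudConst k *
      ((∫ t in (0 : ℝ)..1, t * g t) + ∫ t in (0 : ℝ)..1, (t ^ (1 - k) - t) * g t) := by
  have h := (hg.memL2_profile ⊤).integral_eq le_top hk0 hk1 le_rfl one_pos
  set T := ∫ t in (0 : ℝ)..1, t * g t with hT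
  have e1 : ∫ u in (0 : ℝ)..1, (u ^ (1 - k) - u) * (1 ^ 2 * deriv2 (profile g) (0 + 1 * u)) =
      ∫ t in (0 : ℝ)..1, (t ^ (1 - k) - t) * g t := by
    apply intervalIntegral.integral_congr_ae
    have := (ae_restrict_iff' measurableSet_Ici).1 hg.deriv2_profile
    filter_upwards [this] with t ht htm
    rw [uIoc_of_le zero_le_one] at htm
    simp [ht htm.1.le]
  have e2 : ∫ u in Ioi (1 : ℝ), (profile g 0 - profile g (0 + 1 * u)) / u ^ (1 + k) = T / k := by
    rw [setIntegral_congr_fun (g := fun u => T * (1 / u ^ (1 + k))) measurableSet_Ioi,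
      integral_const_mul, (integral_Ioi_one_rpow hk0).2, mul_one_div]
    intro u hu
    simp only
    rw [zero_add, one_mul, hg.profile_zero, hg.profile_of_one_le (mem_Ioi.1 hu).le]
    ring
  rw [e1, e2, zero_add, hg.profile_of_one_le le_rfl, Real.one_rpow, one_mul, ← hT] at h
  rw [marchaud_eq_const_mul hk0 hk1, h, hg.profile_zero, ← hT]
  field_simp
  ring

theorem le_norm_marchaud_profile {k : ℝ} (hk0 : 0 < k) (hk1 : k < 1)
    (hm : MemLp (marchaud k (profile g)) ⊤ mu) : marchaudConst k *
      ((∫ t in (0 : ℝ)..1, t * g t) + ∫ t in (0 : ℝ)..1, (t ^ (1 - k) - t) * g t) ≤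
    norm ⊤ (marchaud k (profile g)) := by
  rw [← hg.marchaud_profile_zero hk0 hk1]
  exact (le_abs_self _).trans (abs_le_norm_top
    ((hg.memL2_profile ⊤).tame.continuousOn_marchaud hk0 hk1) hm le_rfl)

end Density

/-! ### The kernel `tau` and Hölder duality -/

theorem tau_of_mem {k t : ℝ} (ht : t ∈ Ioo (0 : ℝ) 1) : tau k t = t ^ (1 - k) - t :=
  if_pos ⟨ht.1.le, ht.2⟩

theorem measurable_tau (k : ℝ) : Measurable (tau k) :=
  Measurable.ite measurableSet_Ico (by fun_prop) measurable_const

theorem density_tau {k : ℝ} (hk0 : 0 < k) (hk1 : k < 1) : Density 1 (tau k) := by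
  have hz : ∀ t, t ∉ Ioo (0 : ℝ) 1 → tau k t = 0 := by
    intro t ht
    rw [tau]
    split_ifs with h
    · have : t = 0 := by
        by_contra hne
        exact ht ⟨lt_of_le_of_ne h.1 (Ne.symm hne), h.2⟩
      rw [this, Real.zero_rpow (by linarith), sub_zero]
    · rfl
  refine ⟨measurable_tau k, fun t => ?_, fun t => ?_, hz⟩
  · by_cases ht : t ∈ Ioo (0 : ℝ) 1
    · rw [tau_of_mem ht, sub_nonneg]
      exact Real.self_le_rpow_of_le_one ht.1.le ht.2.le (by linarith)
    · rw [hz t ht]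
  · by_cases ht : t ∈ Ioo (0 : ℝ) 1
    · rw [tau_of_mem ht]
      linarith [Real.rpow_le_one ht.1.le ht.2.le (by linarith : 0 ≤ 1 - k), ht.1]
    · rw [hz t ht]; exact zero_le_one

theorem tau_pos {k t : ℝ} (hk0 : 0 < k) (ht : t ∈ Ioo (0 : ℝ) 1) : 0 < tau k t := by
  rw [tau_of_mem ht, sub_pos]
  exact Real.self_lt_rpow_of_lt_one ht.1 ht.2 (by linarith)

theorem integral_kernel_eq {k : ℝ} (hk0 : 0 < k) (hk1 : k < 1) (w : ℝ → ℝ) :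
    ∫ u in (0 : ℝ)..1, (u ^ (1 - k) - u) * w u = ∫ u, tau k u * w u ∂mu := by
  have h1 : ∫ u, tau k u * w u ∂mu = ∫ u in Ioo (0 : ℝ) 1, tau k u * w u := by
    refine setIntegral_eq_of_subset_of_forall_sdiff_eq_zero measurableSet_Ici
      (fun u hu => hu.1.le) fun u hu => ?_
    rw [(density_tau hk0 hk1).eq_zero u hu.2, zero_mul]
  rw [h1, intervalIntegral.integral_of_le zero_le_one, integral_Ioc_eq_integral_Ioo]
  exact setIntegral_congr_fun measurableSet_Ioo fun u hu => by simp only [tau_of_mem hu]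

theorem kernelBound_tau {k : ℝ} (hk0 : 0 < k) (hk1 : k < 1) {s : ℝ≥0∞} (hs : 1 ≤ s) :
    KernelBound k s (norm s.conjExponent (tau k)) := by
  intro w hw
  have hconj : s.conjExponent.HolderConjugate s :=
    have := ENNReal.HolderConjugate.conjExponent hs
    ENNReal.HolderTriple.symm
  have hτ := (density_tau hk0 hk1).memLp s.conjExponent
  have hH := eLpNorm_smul_le_mul_eLpNorm (p := s.conjExponent) (q := s) (r := 1) hw.1 hτ.1
  have hne := ENNReal.mul_ne_top hτ.eLpNorm_ne_top hw.eLpNorm_ne_top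
  rw [integral_kernel_eq hk0 hk1, norm, norm, ← ENNReal.toReal_mul]
  have h2 : ‖∫ u, tau k u * w u ∂mu‖ₑ ≤ eLpNorm (tau k • w) 1 mu := by
    rw [eLpNorm_one_eq_lintegral_enorm]
    exact enorm_integral_le_lintegral_enorm _
  rw [← Real.norm_eq_abs, ← toReal_enorm]
  exact ENNReal.toReal_mono hne (h2.trans hH)

/-- Strictness matters: at `s = 1` the conjugate exponent is `⊤`, whose `toReal` is `0`. -/
theorem one_le_conjExponent {s : ℝ≥0∞} (hs : 1 < s) : 1 ≤ s.conjExponent.toReal := by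
  have hne : s.conjExponent ≠ ⊤ := by
    rw [ENNReal.conjExponent]
    refine ENNReal.add_ne_top.2 ⟨ENNReal.one_ne_top, ENNReal.inv_ne_top.2 ?_⟩
    exact (tsub_pos_of_lt hs).ne'
  rw [← ENNReal.toReal_one]
  exact ENNReal.toReal_mono hne le_self_add

theorem density_tauPow {k : ℝ} (hk0 : 0 < k) (hk1 : k < 1) {s : ℝ≥0∞} (hs : 1 < s) :
    Density 1 (tauPow k s) where
  measurable := ((measurable_tau k).pow_const _).indicator measurableSet_Ioo
  nonneg t := indicator_nonneg (fun t _ => Real.rpow_nonneg ((density_tau hk0 hk1).nonneg t) _) t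
  le t := indicator_le' (fun t _ => Real.rpow_le_one ((density_tau hk0 hk1).nonneg t)
    ((density_tau hk0 hk1).le t) (by linarith [one_le_conjExponent hs]))
    (fun _ _ => zero_le_one) t
  eq_zero _ ht := indicator_of_notMem ht _

theorem tauPow_pos {k : ℝ} (hk0 : 0 < k) (s : ℝ≥0∞) {t : ℝ}
    (ht : t ∈ Ioo (0 : ℝ) 1) : 0 < tauPow k s t := by
  rw [tauPow, indicator_of_mem ht]
  exact Real.rpow_pos_of_pos (tau_pos hk0 ht) _

theorem Density.integral_id_mul_pos {B : ℝ} {g : ℝ → ℝ} (hg : Density B g)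
    (hpos : ∀ t ∈ Ioo (0 : ℝ) 1, 0 < g t) : 0 < ∫ t in (0 : ℝ)..1, t * g t :=
  intervalIntegral.intervalIntegral_pos_of_pos_on
    ((hg.intervalIntegrable 0 1).continuousOn_mul continuousOn_id)
    (fun t ht => mul_pos ht.1 (hpos t ht)) zero_lt_one

theorem norm_eq_integral_rpow {p : ℝ≥0∞} (hp0 : p ≠ 0) (hp : p ≠ ⊤) {g : ℝ → ℝ}
    (hg : MemLp g p mu) : norm p g = (∫ x, |g x| ^ p.toReal ∂mu) ^ p.toReal⁻¹ := by
  rw [norm, hg.eLpNorm_eq_integral_rpow_norm hp0 hp, ENNReal.toReal_ofReal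
    (Real.rpow_nonneg (integral_nonneg fun _ => Real.rpow_nonneg (norm_nonneg _) _) _)]
  rfl

/-- Equality in Hölder's inequality for the dual power of `tau`. -/
theorem norm_tau_mul_norm_tauPow {k : ℝ} (hk0 : 0 < k) (hk1 : k < 1) {s : ℝ≥0∞} (hs : 1 < s) :
    norm s.conjExponent (tau k) * norm s (tauPow k s) =
      ∫ t in (0 : ℝ)..1, (t ^ (1 - k) - t) * tauPow k s t := by
  rw [integral_kernel_eq hk0 hk1]
  have hτ := density_tau hk0 hk1
  -- For `s = ∞` the dual function is the indicator of `(0, 1)`, of norm `1`, and the claim reads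
  -- `‖tau‖_1 = ∫ tau`.
  rcases eq_or_ne s ⊤ with rfl | htop
  · have hc : ENNReal.conjExponent ⊤ = 1 := by simp [ENNReal.conjExponent]
    have hp : tauPow k ⊤ = (Ioo (0 : ℝ) 1).indicator fun _ => 1 := by
      simp [tauPow, hc]
    have hμ : mu (Ioo 0 1) ≠ 0 := by
      rw [mu, Measure.restrict_apply measurableSet_Ioo,
        inter_eq_left.2 (Ioo_subset_Ioi_self.trans Ioi_subset_Ici_self)]
      simp
    have hn : norm ⊤ (tauPow k ⊤) = 1 := by
      rw [hp, norm, eLpNorm_indicator_const' measurableSet_Ioo hμ ENNReal.top_ne_zero]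
      simp
    rw [hn, mul_one, hc, norm_eq_integral_rpow one_ne_zero ENNReal.one_ne_top (hτ.memLp 1)]
    simp only [ENNReal.toReal_one, Real.rpow_one, inv_one]
    refine integral_congr_ae (ae_of_all _ fun t => ?_)
    by_cases ht : t ∈ Ioo (0 : ℝ) 1
    · simp [hp, ht, abs_of_nonneg (hτ.nonneg t)]
    · simp [hτ.eq_zero t ht]
  · have hconj : s.HolderConjugate s.conjExponent := ENNReal.HolderConjugate.conjExponent hs.le
    have hsr : 1 < s.toReal := by
      rw [← ENNReal.toReal_one]
      exact (ENNReal.toReal_lt_toReal ENNReal.one_ne_top htop).2 hs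
    have hR : s.toReal.HolderConjugate s.conjExponent.toReal := ENNReal.HolderConjugate.toReal hsr
    set p := s.toReal with hp
    set q := s.conjExponent.toReal with hq
    have hq1 : 1 < q := hR.symm.lt
    have hq0 : s.conjExponent ≠ 0 := by
      intro h0; rw [hq, h0] at hq1; simp at hq1; linarith
    have hqt : s.conjExponent ≠ ⊤ := by
      intro h0; rw [hq, h0] at hq1; simp at hq1; linarith
    have hd := density_tauPow hk0 hk1 hs
    rw [norm_eq_integral_rpow hq0 hqt (hτ.memLp _),
      norm_eq_integral_rpow (zero_lt_one.trans hs).ne' htop (hd.memLp _)]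
    -- For conjugate exponents `(q - 1) p = q`, so both norms are powers of `∫ tau ^ q`, with
    -- exponents `1/q` and `1/p` adding up to `1`.
    have e1 : ∀ t, |tauPow k s t| ^ p = |tau k t| ^ q := by
      intro t
      rw [abs_of_nonneg (hτ.nonneg t), abs_of_nonneg (hd.nonneg t)]
      by_cases ht : t ∈ Ioo (0 : ℝ) 1
      · rw [tauPow, indicator_of_mem ht, ← Real.rpow_mul (hτ.nonneg t), ← hq, sub_mul, one_mul,
          mul_comm q p, hR.mul_eq_add, add_sub_cancel_left]
      · rw [hd.eq_zero t ht, hτ.eq_zero t ht, Real.zero_rpow (by linarith),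
          Real.zero_rpow (by linarith)]
    have e2 : ∀ t, tau k t * tauPow k s t = |tau k t| ^ q := by
      intro t
      rw [abs_of_nonneg (hτ.nonneg t)]
      by_cases ht : t ∈ Ioo (0 : ℝ) 1
      · have := tau_pos hk0 ht
        rw [tauPow, indicator_of_mem ht, ← hq, Real.rpow_sub_one this.ne']
        field_simp
      · rw [hd.eq_zero t ht, hτ.eq_zero t ht, Real.zero_rpow (by linarith), zero_mul]
    simp only [← hp, ← hq, e1, e2]
    rw [← Real.rpow_add_of_nonneg (integral_nonneg fun _ => Real.rpow_nonneg (abs_nonneg _) _)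
      (by positivity) (by positivity), hR.symm.inv_add_inv_eq_one, Real.rpow_one]

theorem norm_tauPow_pos {k : ℝ} (hk0 : 0 < k) (hk1 : k < 1) {s : ℝ≥0∞} (hs : 1 < s) :
    0 < norm s (tauPow k s) := by
  have hd := density_tauPow hk0 hk1 hs
  refine lt_of_le_of_ne (norm_real_nonneg _ _) fun h0 => ?_
  have h1 := norm_tau_mul_norm_tauPow hk0 hk1 hs
  rw [← h0, mul_zero] at h1
  have h2 : 0 < ∫ t in (0 : ℝ)..1, (t ^ (1 - k) - t) * tauPow k s t := by
    refine intervalIntegral.intervalIntegral_pos_of_pos_on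
      ((hd.intervalIntegrable 0 1).continuousOn_mul ?_) (fun t ht => ?_) zero_lt_one
    · exact ((Real.continuous_rpow_const (by linarith)).sub continuous_id).continuousOn
    · rw [← tau_of_mem ht]
      exact mul_pos (tau_pos hk0 ht) (tauPow_pos hk0 s ht)
  exact h2.ne h1

/-! ### The extremal function for `s > 1` -/

/-- The second derivative of `Phi` for `s > 1`. -/
noncomputable def extremalDensity (k : ℝ) (s : ℝ≥0∞) (t : ℝ) : ℝ :=
  (norm s (tauPow k s))⁻¹ * tauPow k s t

theorem density_extremalDensity {k : ℝ} (hk0 : 0 < k) (hk1 : k < 1) {s : ℝ≥0∞} (hs : 1 < s) :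
    Density (norm s (tauPow k s))⁻¹ (extremalDensity k s) := by
  have hd := density_tauPow hk0 hk1 hs
  have hn := inv_pos.2 (norm_tauPow_pos hk0 hk1 hs)
  refine ⟨hd.measurable.const_mul _, fun t => mul_nonneg hn.le (hd.nonneg t), fun t => ?_,
    fun t ht => ?_⟩
  · exact mul_le_of_le_one_right hn.le (hd.le t)
  · rw [extremalDensity, hd.eq_zero t ht, mul_zero]

theorem Phi_eq_profile {k : ℝ} (hk0 : 0 < k) (hk1 : k < 1) {s : ℝ≥0∞} (hs : 1 < s) :
    Phi k s = profile (extremalDensity k s) := by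
  have hd := density_tauPow hk0 hk1 hs
  have hphi : phi k s = profile (tauPow k s) := rfl
  ext x
  rw [Phi, if_neg hs.ne', hphi, hd.norm_deriv2_profile, profile, profile, mul_add,
    ← intervalIntegral.integral_const_mul, ← intervalIntegral.integral_const_mul]
  simp only [extremalDensity, mul_left_comm]

theorem norm_extremalDensity {k : ℝ} (hk0 : 0 < k) (hk1 : k < 1) {s : ℝ≥0∞} (hs : 1 < s) :
    norm s (extremalDensity k s) = 1 := by
  have hn := norm_tauPow_pos hk0 hk1 hs
  rw [show extremalDensity k s = fun t => (norm s (tauPow k s))⁻¹ * tauPow k s t from rfl,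
    norm_const_mul (inv_pos.2 hn).le, inv_mul_cancel₀ hn.ne']

theorem integral_kernel_extremalDensity {k : ℝ} (hk0 : 0 < k) (hk1 : k < 1) {s : ℝ≥0∞}
    (hs : 1 < s) : ∫ t in (0 : ℝ)..1, (t ^ (1 - k) - t) * extremalDensity k s t =
      norm s.conjExponent (tau k) := by
  have hn := norm_tauPow_pos hk0 hk1 hs
  simp only [extremalDensity, mul_left_comm]
  rw [intervalIntegral.integral_const_mul, ← norm_tau_mul_norm_tauPow hk0 hk1 hs]
  field_simp

theorem MemL2.memLp_marchaud {s : ℝ≥0∞} (hs : 1 ≤ s) {f : ℝ → ℝ} (hf : MemL2 s f) {k : ℝ}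
    (hk0 : 0 < k) (hk1 : k < 1) : MemLp (marchaud k f) ⊤ mu :=
  memLp_top_of_continuousOn (hf.tame.continuousOn_marchaud hk0 hk1) fun _ hx =>
    hf.abs_marchaud_le hs hk0 hk1 (norm_real_nonneg _ _) (kernelBound_tau hk0 hk1 hs) one_pos hx

theorem norm_Phi_pos {k : ℝ} (hk0 : 0 < k) (hk1 : k < 1) {s : ℝ≥0∞} (hs : 1 < s) :
    0 < norm ⊤ (Phi k s) := by
  have hd := density_extremalDensity hk0 hk1 hs
  rw [Phi_eq_profile hk0 hk1 hs, hd.norm_profile]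
  exact half_pos (hd.integral_id_mul_pos fun t ht =>
    mul_pos (inv_pos.2 (norm_tauPow_pos hk0 hk1 hs)) (tauPow_pos hk0 s ht))

theorem memL2_Phi {k : ℝ} (hk0 : 0 < k) (hk1 : k < 1) {s : ℝ≥0∞} (hs : 1 < s) :
    MemL2 s (Phi k s) := by
  rw [Phi_eq_profile hk0 hk1 hs]
  exact (density_extremalDensity hk0 hk1 hs).memL2_profile s

theorem norm_deriv2_Phi {k : ℝ} (hk0 : 0 < k) (hk1 : k < 1) {s : ℝ≥0∞} (hs : 1 < s) :
    norm s (deriv2 (Phi k s)) = 1 := by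
  rw [Phi_eq_profile hk0 hk1 hs, (density_extremalDensity hk0 hk1 hs).norm_deriv2_profile,
    norm_extremalDensity hk0 hk1 hs]

/-- The upper bound is the general inequality with `M = ‖Phi‖_∞` and `‖Phi''‖_s = 1`, where the
powers of `M` cancel; the value at `0` attains it. -/
theorem norm_marchaud_Phi {k : ℝ} (hk0 : 0 < k) (hk1 : k < 1) {s : ℝ≥0∞} (hs : 1 < s) :
    norm ⊤ (marchaud k (Phi k s)) =
      marchaudConst k * (2 * norm ⊤ (Phi k s) + norm s.conjExponent (tau k)) := by
  have hd := density_extremalDensity hk0 hk1 hs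
  have hP := memL2_Phi hk0 hk1 hs
  have hM := norm_Phi_pos hk0 hk1 hs
  refine le_antisymm (norm_top_le fun x hx => ?_) ?_
  · refine (hP.abs_marchaud_le hs.le hk0 hk1 (norm_real_nonneg _ _)
      (kernelBound_tau hk0 hk1 hs.le) hM hx).trans (le_of_eq ?_)
    rw [norm_deriv2_Phi hk0 hk1 hs, Real.one_rpow, mul_one,
      div_mul_cancel₀ _ (Real.rpow_pos_of_pos hM _).ne']
  · have h := hP.memLp_marchaud hs.le hk0 hk1
    rw [Phi_eq_profile hk0 hk1 hs] at h ⊢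
    have h2 := hd.le_norm_marchaud_profile hk0 hk1 h
    rwa [integral_kernel_extremalDensity hk0 hk1 hs,
      show ∫ t in (0 : ℝ)..1, t * extremalDensity k s t =
        2 * norm ⊤ (profile (extremalDensity k s)) by rw [hd.norm_profile]; ring] at h2

/-! ### The extremal function for `s = 1` -/

/-- The point where `tau` attains its maximum, and where `Phi k 1` has its kink. -/
noncomputable def kink (k : ℝ) : ℝ := (1 - k) ^ (1 / k)

theorem kink_pos {k : ℝ} (hk1 : k < 1) : 0 < kink k := Real.rpow_pos_of_pos (by linarith) _

theorem kink_lt_one {k : ℝ} (hk0 : 0 < k) (hk1 : k < 1) : kink k < 1 :=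
  Real.rpow_lt_one (by linarith) (by linarith) (by positivity)

theorem kink_rpow {k : ℝ} (hk0 : 0 < k) (hk1 : k < 1) : kink k ^ (1 - k) = kink k / (1 - k) := by
  have h : kink k ^ k = 1 - k := by
    rw [kink, ← Real.rpow_mul (by linarith), one_div_mul_cancel hk0.ne', Real.rpow_one]
  rw [Real.rpow_sub (kink_pos hk1), Real.rpow_one, h]

/-- Bernoulli's inequality puts the concave `t ^ (1 - k)` below its tangent at the kink, whose slope
is `(1 - k) * kink k ^ (-k) = 1`; subtracting `t` leaves a constant. -/
theorem tau_le_tau_kink {k : ℝ} (hk0 : 0 < k) (hk1 : k < 1) (t : ℝ) :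
    tau k t ≤ kink k ^ (1 - k) - kink k := by
  have hc := kink_pos hk1
  by_cases ht : t ∈ Ioo (0 : ℝ) 1
  · rw [tau_of_mem ht]
    have hb := rpow_one_add_le_one_add_mul_self (s := t / kink k - 1) (p := 1 - k)
      (by linarith [div_pos ht.1 hc]) (by linarith) (by linarith)
    rw [add_sub_cancel, Real.div_rpow ht.1.le hc.le, div_le_iff₀ (Real.rpow_pos_of_pos hc _)] at hb
    have : (1 + (1 - k) * (t / kink k - 1)) * kink k ^ (1 - k) =
        kink k ^ (1 - k) + (t - kink k) := by
      have hk : 1 - k ≠ 0 := by linarith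
      rw [kink_rpow hk0 hk1]
      field_simp
    linarith
  · rw [(density_tau hk0 hk1).eq_zero t ht, sub_nonneg]
    exact Real.self_le_rpow_of_le_one hc.le (kink_lt_one hk0 hk1).le (by linarith)

theorem kernelBound_one {k : ℝ} (hk0 : 0 < k) (hk1 : k < 1) :
    KernelBound k 1 (kink k ^ (1 - k) - kink k) := by
  intro w hw
  refine (kernelBound_tau hk0 hk1 le_rfl w hw).trans ?_
  refine mul_le_mul_of_nonneg_right ?_ (norm_real_nonneg _ _)
  rw [show ENNReal.conjExponent 1 = ⊤ by simp [ENNReal.conjExponent]]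
  refine norm_top_le fun x _ => ?_
  rw [abs_of_nonneg ((density_tau hk0 hk1).nonneg x)]
  exact tau_le_tau_kink hk0 hk1 x

theorem Phi_one (k x : ℝ) : Phi k 1 x = (1 / 2) * max (kink k - 2 * x) (-kink k) := by
  rw [Phi, if_pos rfl, kink]

theorem tame_Phi_one {k : ℝ} (hk1 : k < 1) : Tame (kink k / 2) (Phi k 1) where
  continuousOn := by
    rw [funext (Phi_one k)]
    fun_prop
  abs_le x hx := by
    have hc := kink_pos hk1
    rw [Phi_one, abs_le]
    constructor
    · linarith [le_max_right (kink k - 2 * x) (-kink k)]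
    · linarith [max_le (by linarith : kink k - 2 * x ≤ kink k) (by linarith : -kink k ≤ kink k)]
  lipschitz b := by
    refine ⟨1, fun x _ y _ => ?_⟩
    rw [Phi_one, Phi_one, ← mul_sub, abs_mul]
    have h := abs_max_sub_max_le_abs (kink k - 2 * x) (kink k - 2 * y) (-kink k)
    rw [show kink k - 2 * x - (kink k - 2 * y) = -2 * (x - y) by ring, abs_mul] at h
    norm_num at h ⊢
    linarith

theorem norm_Phi_one {k : ℝ} (hk1 : k < 1) : norm ⊤ (Phi k 1) = kink k / 2 := by
  have ht := tame_Phi_one hk1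
  refine le_antisymm (norm_top_le ht.abs_le) ?_
  have h := abs_le_norm_top ht.continuousOn (memLp_top_of_continuousOn ht.continuousOn ht.abs_le)
    le_rfl
  refine le_trans (le_of_eq ?_) ((le_abs_self _).trans h)
  have hc := kink_pos hk1
  rw [Phi_one, max_eq_left (by linarith)]
  ring

/-- In this form the increments are visibly nonnegative and nonincreasing in `x`, so the Marchaud
derivative is nonnegative and largest at `x = 0`. -/
theorem Phi_one_sub (k x t : ℝ) (ht : 0 ≤ t) :
    Phi k 1 x - Phi k 1 (x + t) = min t (max (kink k - x) 0) := by
  rw [Phi_one, Phi_one]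
  rcases max_cases (kink k - 2 * x) (-kink k) with h1 | h1 <;>
  rcases max_cases (kink k - 2 * (x + t)) (-kink k) with h2 | h2 <;>
  rcases max_cases (kink k - x) 0 with h3 | h3 <;>
  rcases min_cases t (max (kink k - x) 0) with h4 | h4 <;>
  linarith

theorem integral_Phi_one_zero {k : ℝ} (hk0 : 0 < k) (hk1 : k < 1) :
    k * (1 - k) * ∫ t in Ioi (0 : ℝ), (Phi k 1 0 - Phi k 1 (0 + t)) / t ^ (1 + k) =
      kink k ^ (1 - k) := by
  have hc := kink_pos hk1
  have hi := (tame_Phi_one hk1).integrableOn hk0 hk1 le_rfl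
  -- At `x = 0` the increment is `min t (kink k)`, so the integral splits at the kink into two pure
  -- powers.
  rw [← Ioc_union_Ioi_eq_Ioi hc.le, setIntegral_union (Ioc_disjoint_Ioi le_rfl) measurableSet_Ioi
    (hi.mono_set Ioc_subset_Ioi_self) (hi.mono_set (Ioi_subset_Ioi hc.le))]
  have e1 : ∫ t in Ioc 0 (kink k), (Phi k 1 0 - Phi k 1 (0 + t)) / t ^ (1 + k) =
      kink k ^ (1 - k) / (1 - k) := by
    rw [setIntegral_congr_fun (g := fun t : ℝ => t ^ (-k)) measurableSet_Ioc,
      ← intervalIntegral.integral_of_le hc.le, integral_rpow (Or.inl (by linarith)),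
      show -k + 1 = 1 - k by ring, Real.zero_rpow (by linarith), sub_zero]
    intro t ht
    simp only
    rw [Phi_one_sub k 0 t ht.1.le, sub_zero, max_eq_left hc.le, min_eq_left ht.2,
      Real.rpow_add ht.1, Real.rpow_one, Real.rpow_neg ht.1.le]
    have := ht.1
    field_simp
  have e2 : ∫ t in Ioi (kink k), (Phi k 1 0 - Phi k 1 (0 + t)) / t ^ (1 + k) =
      kink k ^ (1 - k) / k := by
    rw [setIntegral_congr_fun (g := fun t : ℝ => kink k * t ^ (-1 - k)) measurableSet_Ioi,
      integral_const_mul, integral_Ioi_rpow_of_lt (by linarith) hc,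
      show -1 - k + 1 = -k by ring, neg_div_neg_eq, sub_eq_add_neg, Real.rpow_add hc, Real.rpow_one,
      mul_div_assoc]
    intro t ht
    have ht0 : 0 < t := hc.trans ht
    simp only
    rw [Phi_one_sub k 0 t ht0.le, sub_zero, max_eq_left hc.le, min_eq_right (mem_Ioi.1 ht).le,
      show -1 - k = -(1 + k) by ring, Real.rpow_neg ht0.le]
    rfl
  rw [e1, e2]
  have : 1 - k ≠ 0 := by linarith
  field_simp
  ring

theorem marchaud_Phi_one_zero {k : ℝ} (hk0 : 0 < k) (hk1 : k < 1) :
    marchaud k (Phi k 1) 0 = marchaudConst k * kink k ^ (1 - k) := by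
  rw [marchaud_eq_const_mul hk0 hk1, integral_Phi_one_zero hk0 hk1]

theorem abs_marchaud_Phi_one_le {k : ℝ} (hk0 : 0 < k) (hk1 : k < 1) {x : ℝ} (hx : 0 ≤ x) :
    |marchaud k (Phi k 1) x| ≤ marchaudConst k * kink k ^ (1 - k) := by
  have hc := kink_pos hk1
  have ht := tame_Phi_one hk1
  have hk : 0 < k * (1 - k) := mul_pos hk0 (by linarith)
  rw [← integral_Phi_one_zero hk0 hk1, marchaud_eq_const_mul hk0 hk1, abs_of_nonneg]
  · refine mul_le_mul_of_nonneg_left (mul_le_mul_of_nonneg_left ?_ hk.le)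
      (marchaudConst_pos hk0 hk1).le
    refine setIntegral_mono_on (ht.integrableOn hk0 hk1 hx) (ht.integrableOn hk0 hk1 le_rfl)
      measurableSet_Ioi fun t ht => ?_
    have ht0 : 0 < t := ht
    rw [Phi_one_sub k x t ht0.le, Phi_one_sub k 0 t ht0.le]
    refine div_le_div_of_nonneg_right ?_ (Real.rpow_nonneg ht0.le _)
    gcongr
  · refine mul_nonneg (marchaudConst_pos hk0 hk1).le (mul_nonneg hk.le ?_)
    refine setIntegral_nonneg measurableSet_Ioi fun t ht => ?_
    have ht0 : 0 < t := ht
    rw [Phi_one_sub k x t ht0.le]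
    exact div_nonneg (le_min ht0.le (le_max_right _ _)) (Real.rpow_nonneg ht0.le _)

theorem memLp_marchaud_Phi_one {k : ℝ} (hk0 : 0 < k) (hk1 : k < 1) :
    MemLp (marchaud k (Phi k 1)) ⊤ mu :=
  memLp_top_of_continuousOn ((tame_Phi_one hk1).continuousOn_marchaud hk0 hk1) fun _ hx =>
    abs_marchaud_Phi_one_le hk0 hk1 hx

theorem norm_marchaud_Phi_one {k : ℝ} (hk0 : 0 < k) (hk1 : k < 1) :
    norm ⊤ (marchaud k (Phi k 1)) = marchaudConst k * kink k ^ (1 - k) := by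
  refine le_antisymm (norm_top_le fun _ hx => abs_marchaud_Phi_one_le hk0 hk1 hx) ?_
  rw [← marchaud_Phi_one_zero hk0 hk1]
  exact (le_abs_self _).trans (abs_le_norm_top
    ((tame_Phi_one hk1).continuousOn_marchaud hk0 hk1) (memLp_marchaud_Phi_one hk0 hk1) le_rfl)

/-! ### Sharpness and the best constant -/

/-- The uniform probability density on `(c - ε, c + ε)`. -/
noncomputable def bump (c ε : ℝ) : ℝ → ℝ := (Ioo (c - ε) (c + ε)).indicator fun _ => (2 * ε)⁻¹

section Bump

variable {c ε : ℝ}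

theorem density_bump (hε : 0 < ε) (h0 : 0 ≤ c - ε) (h1 : c + ε ≤ 1) :
    Density (2 * ε)⁻¹ (bump c ε) where
  measurable := measurable_const.indicator measurableSet_Ioo
  nonneg t := indicator_nonneg (fun _ _ => by positivity) t
  le t := indicator_le' (fun _ _ => le_rfl) (fun _ _ => by positivity) t
  eq_zero t ht := indicator_of_notMem (fun h => ht ⟨h0.trans_lt h.1, h.2.trans_le h1⟩) _

theorem norm_bump (hε : 0 < ε) (h0 : 0 ≤ c - ε) : norm 1 (bump c ε) = 1 := by
  have hμ : mu (Ioo (c - ε) (c + ε)) = ENNReal.ofReal (2 * ε) := by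
    rw [mu, Measure.restrict_apply measurableSet_Ioo, inter_eq_left.2, Real.volume_Ioo]
    · congr 1; ring
    · exact fun x hx => h0.trans hx.1.le
  rw [norm, bump, eLpNorm_indicator_const measurableSet_Ioo one_ne_zero ENNReal.one_ne_top, hμ]
  have h2 : (0 : ℝ) < 2 * ε := by positivity
  simp only [ENNReal.toReal_one, div_one, ENNReal.rpow_one, ENNReal.toReal_mul, toReal_enorm]
  rw [ENNReal.toReal_ofReal h2.le, Real.norm_of_nonneg (inv_pos.2 h2).le, inv_mul_cancel₀ h2.ne']

theorem integral_mul_bump (hε : 0 < ε) (h0 : 0 ≤ c - ε) (h1 : c + ε ≤ 1) (h : ℝ → ℝ) :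
    ∫ t in (0 : ℝ)..1, h t * bump c ε t = (2 * ε)⁻¹ * ∫ t in (c - ε)..(c + ε), h t := by
  rw [intervalIntegral.integral_of_le zero_le_one, intervalIntegral.integral_of_le (by linarith),
    integral_Ioc_eq_integral_Ioo (x := c - ε), ← integral_const_mul]
  have e : (fun t => h t * bump c ε t) =
      (Ioo (c - ε) (c + ε)).indicator fun t => (2 * ε)⁻¹ * h t := by
    ext t
    by_cases ht : t ∈ Ioo (c - ε) (c + ε)
    · simp only [bump, indicator_of_mem ht, mul_comm]
    · simp only [bump, indicator_of_notMem ht, mul_zero]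
  rw [e, setIntegral_indicator measurableSet_Ioo, inter_eq_right.2]
  exact fun t ht => ⟨h0.trans_lt ht.1, (ht.2.trans_le h1).le⟩

theorem integral_id_mul_bump (hε : 0 < ε) (h0 : 0 ≤ c - ε) (h1 : c + ε ≤ 1) :
    ∫ t in (0 : ℝ)..1, t * bump c ε t = c := by
  rw [integral_mul_bump hε h0 h1 fun t => t, integral_id]
  field_simp
  ring

theorem le_integral_mul_bump (hε : 0 < ε) (h0 : 0 ≤ c - ε) (h1 : c + ε ≤ 1) {h : ℝ → ℝ}
    (hh : Continuous h) {m : ℝ} (hm : ∀ t ∈ Icc (c - ε) (c + ε), m ≤ h t) :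
    m ≤ ∫ t in (0 : ℝ)..1, h t * bump c ε t := by
  rw [integral_mul_bump hε h0 h1]
  have := intervalIntegral.integral_mono_on (μ := volume) (by linarith : c - ε ≤ c + ε)
    intervalIntegrable_const (hh.intervalIntegrable _ _) hm
  rw [intervalIntegral.integral_const, smul_eq_mul, show c + ε - (c - ε) = 2 * ε by ring] at this
  rw [inv_mul_eq_div, le_div_iff₀ (by positivity)]
  linarith

end Bump

/-- Functions whose second derivatives concentrate at the kink show that the constant for `s = 1`
cannot be improved. -/
theorem sharp_one {k : ℝ} (hk0 : 0 < k) (hk1 : k < 1) {K : ℝ}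
    (hK : ∀ f : ℝ → ℝ, MemL2 1 f → norm ⊤ (marchaud k f) ≤
      K * norm ⊤ f ^ (1 - lam k 1) * norm 1 (deriv2 f) ^ lam k 1) :
    marchaudConst k * kink k ^ (1 - k) ≤ K * (kink k / 2) ^ (1 - lam k 1) := by
  have hC := marchaudConst_pos hk0 hk1
  have hc0 := kink_pos hk1
  have hc1 := kink_lt_one hk0 hk1
  have hcont : Continuous fun t : ℝ => t ^ (1 - k) - t :=
    (Real.continuous_rpow_const (by linarith)).sub continuous_id
  have main : ∀ δ : ℝ, 0 < δ →
      marchaudConst k * (kink k ^ (1 - k) - δ) ≤ K * (kink k / 2) ^ (1 - lam k 1) := by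
    intro δ hδ
    obtain ⟨η, hη, hηs⟩ := Metric.continuousAt_iff.1 (hcont.continuousAt (x := kink k)) δ hδ
    -- The bump must lie where the kernel is within `δ` of its maximum, and inside `[0, 1]`.
    obtain ⟨ε, hε, hεm⟩ := exists_between (lt_min hη (lt_min hc0 (sub_pos.2 hc1)))
    obtain ⟨hε1, hε2⟩ := lt_min_iff.1 hεm
    obtain ⟨hε2, hε3⟩ := lt_min_iff.1 hε2
    have h0 : 0 ≤ kink k - ε := by linarith
    have h1 : kink k + ε ≤ 1 := by linarith
    have hd := density_bump hε h0 h1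
    have hm := hd.memL2_profile 1
    -- By symmetry the mean of the bump is exactly `kink k`, so the profile has sup norm `kink k /
    -- 2` for every `ε`. Only its integral against the kernel depends on `ε`.
    have hT := integral_id_mul_bump hε h0 h1
    have hle := hd.le_norm_marchaud_profile hk0 hk1 (hm.memLp_marchaud le_rfl hk0 hk1)
    have hb := hK _ hm
    rw [hd.norm_profile, hd.norm_deriv2_profile, norm_bump hε h0, Real.one_rpow, mul_one, hT] at hb
    have hτ : kink k ^ (1 - k) - kink k - δ ≤
        ∫ t in (0 : ℝ)..1, (t ^ (1 - k) - t) * bump (kink k) ε t := by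
      refine le_integral_mul_bump hε h0 h1 hcont fun t ht => ?_
      have hdist : dist t (kink k) < η := by
        rw [Real.dist_eq, abs_lt]
        constructor <;> linarith [ht.1, ht.2]
      have := hηs hdist
      rw [Real.dist_eq, abs_lt] at this
      linarith [this.1]
    refine le_trans ?_ (hle.trans hb)
    rw [hT]
    exact mul_le_mul_of_nonneg_left (by linarith) hC.le
  refine le_of_forall_pos_le_add fun δ hδ => ?_
  have h := main (δ / marchaudConst k) (div_pos hδ hC)
  rw [mul_sub, mul_div_cancel₀ _ hC.ne'] at h
  linarith

/-- With `M = kink k / 2` and `N` the maximum of `tau`, `2 M + N` is `kink k ^ (1 - k)`, the factor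
found for the Marchaud derivative of `Phi k 1`. -/
theorem isLeast_sharpConst_one {k : ℝ} (hk0 : 0 < k) (hk1 : k < 1) :
    IsLeast {K : ℝ | ∀ f : ℝ → ℝ, MemL2 1 f → norm ⊤ (marchaud k f) ≤
      K * norm ⊤ f ^ (1 - lam k 1) * norm 1 (deriv2 f) ^ lam k 1} (sharpConst k 1) := by
  have hM : 0 < kink k / 2 := half_pos (kink_pos hk1)
  rw [sharpConst, norm_Phi_one hk1, norm_marchaud_Phi_one hk0 hk1]
  refine ⟨fun f hf => norm_top_le fun x hx => ?_, fun K hK => ?_⟩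
  · have hN : 0 ≤ kink k ^ (1 - k) - kink k :=
      ((density_tau hk0 hk1).nonneg 0).trans (tau_le_tau_kink hk0 hk1 0)
    have h := hf.abs_marchaud_le le_rfl hk0 hk1 hN (kernelBound_one hk0 hk1) hM hx
    rwa [show 2 * (kink k / 2) + (kink k ^ (1 - k) - kink k) = kink k ^ (1 - k) by ring] at h
  · rw [div_le_iff₀ (Real.rpow_pos_of_pos hM _)]
    exact sharp_one hk0 hk1 hK

theorem isLeast_sharpConst {k : ℝ} (hk0 : 0 < k) (hk1 : k < 1) {s : ℝ≥0∞} (hs : 1 < s) :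
    IsLeast {K : ℝ | ∀ f : ℝ → ℝ, MemL2 s f → norm ⊤ (marchaud k f) ≤
      K * norm ⊤ f ^ (1 - lam k s) * norm s (deriv2 f) ^ lam k s} (sharpConst k s) := by
  have hM := norm_Phi_pos hk0 hk1 hs
  refine ⟨fun f hf => norm_top_le fun x hx => ?_, fun K hK => ?_⟩
  · rw [sharpConst, norm_marchaud_Phi hk0 hk1 hs]
    exact hf.abs_marchaud_le hs.le hk0 hk1 (norm_real_nonneg _ _) (kernelBound_tau hk0 hk1 hs.le)
      hM hx
  · have h := hK _ (memL2_Phi hk0 hk1 hs)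
    rw [norm_deriv2_Phi hk0 hk1 hs, Real.one_rpow, mul_one] at h
    rwa [sharpConst, div_le_iff₀ (Real.rpow_pos_of_pos hM _)]

end HalfLine

theorem mainTheorem8 (k : ℝ) (hk0 : 0 < k) (hk1 : k < 1) (s : ℝ≥0∞) (hs : 1 ≤ s) :
    -- the derivative exists everywhere and is essentially bounded, for every `f` in the space
    (∀ f : ℝ → ℝ, HalfLine.MemL2 s f →
      (∀ x : ℝ, 0 ≤ x → HalfLine.MarchaudExists k f x) ∧
      MemLp (HalfLine.marchaud k f) ⊤ HalfLine.mu) ∧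
    -- the constant is a quotient of finite norms, with a nonzero denominator
    (MemLp (HalfLine.Phi k s) ⊤ HalfLine.mu ∧ 0 < HalfLine.norm ⊤ (HalfLine.Phi k s) ∧
      (∀ x : ℝ, 0 ≤ x → HalfLine.MarchaudExists k (HalfLine.Phi k s) x) ∧
      MemLp (HalfLine.marchaud k (HalfLine.Phi k s)) ⊤ HalfLine.mu) ∧
    -- the inequality holds, and with no smaller constant
    IsLeast {K : ℝ | ∀ f : ℝ → ℝ, HalfLine.MemL2 s f →
        HalfLine.norm ⊤ (HalfLine.marchaud k f) ≤
          K * HalfLine.norm ⊤ f ^ (1 - HalfLine.lam k s) *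
            HalfLine.norm s (HalfLine.deriv2 f) ^ HalfLine.lam k s}
      (HalfLine.sharpConst k s) ∧
    -- for `s > 1` the function `Phi` belongs to the space and turns it into an equality
    (1 < s → HalfLine.MemL2 s (HalfLine.Phi k s) ∧
      HalfLine.norm s (HalfLine.deriv2 (HalfLine.Phi k s)) = 1 ∧
      HalfLine.norm ⊤ (HalfLine.marchaud k (HalfLine.Phi k s)) =
        HalfLine.sharpConst k s * HalfLine.norm ⊤ (HalfLine.Phi k s) ^ (1 - HalfLine.lam k s) *
          HalfLine.norm s (HalfLine.deriv2 (HalfLine.Phi k s)) ^ HalfLine.lam k s) := by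
  
  refine ⟨fun f hf => ⟨fun x hx => hf.tame.marchaudExists hk0 hk1 hx,
    hf.memLp_marchaud hs hk0 hk1⟩, ?_⟩
  rcases hs.eq_or_lt with rfl | hs1
  · have ht := HalfLine.tame_Phi_one hk1
    refine ⟨⟨HalfLine.memLp_top_of_continuousOn ht.continuousOn ht.abs_le, ?_,
      fun x hx => ht.marchaudExists hk0 hk1 hx, HalfLine.memLp_marchaud_Phi_one hk0 hk1⟩,
      HalfLine.isLeast_sharpConst_one hk0 hk1, fun h => absurd h (lt_irrefl _)⟩
    rw [HalfLine.norm_Phi_one hk1]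
    exact half_pos (HalfLine.kink_pos hk1)
  · have hP := HalfLine.memL2_Phi hk0 hk1 hs1
    have hM := HalfLine.norm_Phi_pos hk0 hk1 hs1
    have hn := HalfLine.norm_deriv2_Phi hk0 hk1 hs1
    refine ⟨⟨hP.memLp, hM, fun x hx => hP.tame.marchaudExists hk0 hk1 hx,
      hP.memLp_marchaud hs hk0 hk1⟩, HalfLine.isLeast_sharpConst hk0 hk1 hs1,
      fun _ => ⟨hP, hn, ?_⟩⟩
    rw [hn, Real.one_rpow, mul_one, HalfLine.sharpConst,
      div_mul_cancel₀ _ (Real.rpow_pos_of_pos hM _).ne']
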